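/- Let $n,p\ge 0$ be integers, and let $M^n$ be a non-empty compact (Hausdorff) smooth $n$-dimensional manifold without boundary. Let $X:M^n\to\mathbf R^{n+p}$ be a self-shrinker, that is, a smooth immersion satisfying $H=-X^N$. Here, for $x\in M^n$, $X^N(x)$ is the orthogonal projection of the position vector $X(x)$ to the normal space of the immersion at $x$, and $H$ is the mean curvature vector, the (unnormalized) trace of the second fundamental form with respect to the metric induced on $M^n$ by $X$. Let $dv$ be the Riemannian measure of the induced metric. Then $$\min_{M^n}|X|^2\;\le\; n=\frac{\int_{M^n}|X|^2\,e^{-\frac{|X|^2}{2}}\,dv}{\int_{M^n}e^{-\frac{|X|^2}{2}}\,dv}\;\le\;\max_{M^n}|X^N|^2 ,$$ where the minimum and the maximum are attained, both integrals converge and the denominator is positive. -/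

import Mathlib

open scoped Manifold ContDiff

namespace Submfd

variable {n m : ℕ} {M : Type*} [TopologicalSpace M] [ChartedSpace (EuclideanSpace ℝ (Fin n)) M]

/-- The tangent space `dX(T_x M)` at `x` of the immersed submanifold `X : M → ℝᵐ`, as a linear
subspace of `ℝᵐ`. -/
noncomputable def tangentPlane (X : M → EuclideanSpace ℝ (Fin m)) (x : M) :
    Submodule ℝ (EuclideanSpace ℝ (Fin m)) :=
  LinearMap.range (ContinuousLinearMap.toLinearMap (M := EuclideanSpace ℝ (Fin n))
    (M₂ := EuclideanSpace ℝ (Fin m)) (mfderiv (𝓡 n) (𝓡 m) X x))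

/-- The component `v^N` of a vector `v` of `ℝᵐ` normal to the submanifold `X : M → ℝᵐ` at `x`:
the orthogonal projection of `v` to the normal space of `M` at `x`. -/
noncomputable def normalPart (X : M → EuclideanSpace ℝ (Fin m)) (x : M)
    (v : EuclideanSpace ℝ (Fin m)) : EuclideanSpace ℝ (Fin m) :=
  (tangentPlane (n := n) X x)ᗮ.starProjection v

/-- The matrix `g_ij = ⟨∂_i X, ∂_j X⟩` of the induced metric, in the coordinates of the chart `e`,
at the point with coordinates `y`. -/
noncomputable def metricMatrix (X : M → EuclideanSpace ℝ (Fin m))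
    (e : OpenPartialHomeomorph M (EuclideanSpace ℝ (Fin n))) (y : EuclideanSpace ℝ (Fin n)) :
    Matrix (Fin n) (Fin n) ℝ :=
  Matrix.of fun i j =>
    inner ℝ (fderiv ℝ (X ∘ e.symm) y (EuclideanSpace.single i 1))
      (fderiv ℝ (X ∘ e.symm) y (EuclideanSpace.single j 1))

/-- The coefficients `h_ij = (∂_i ∂_j X)^N` of the (vector valued) second fundamental form at `x`,
in the coordinates of the chart `e`. -/
noncomputable def secondFundamentalForm (X : M → EuclideanSpace ℝ (Fin m))
    (e : OpenPartialHomeomorph M (EuclideanSpace ℝ (Fin n))) (x : M) (i j : Fin n) :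
    EuclideanSpace ℝ (Fin m) :=
  normalPart (n := n) X x
    (fderiv ℝ (fderiv ℝ (X ∘ e.symm)) (e x) (EuclideanSpace.single i 1)
      (EuclideanSpace.single j 1))

/-- The trace `∑ g^{ij} h_ij` of the second fundamental form at `x` with respect to the induced
metric, computed in the chart `e`. -/
noncomputable def meanCurvatureInChart (X : M → EuclideanSpace ℝ (Fin m))
    (e : OpenPartialHomeomorph M (EuclideanSpace ℝ (Fin n))) (x : M) :
    EuclideanSpace ℝ (Fin m) :=
  ∑ i, ∑ j, (metricMatrix X e (e x))⁻¹ i j • secondFundamentalForm X e x i j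

section Charts

variable {X : M → EuclideanSpace ℝ (Fin m)}
  {e e' : OpenPartialHomeomorph M (EuclideanSpace ℝ (Fin n))} {x : M}

theorem contDiffAt_comp_symm [IsManifold (𝓡 n) ∞ M] (hX : ContMDiff (𝓡 n) (𝓡 m) ∞ X)
    (he : e ∈ IsManifold.maximalAtlas (𝓡 n) ∞ M) {y : EuclideanSpace ℝ (Fin n)}
    (hy : y ∈ e.target) : ContDiffAt ℝ ∞ (X ∘ e.symm) y := by
  have h1 : ContMDiffAt (𝓡 n) (𝓡 n) ∞ e.symm y :=
    (contMDiffOn_symm_of_mem_maximalAtlas he).contMDiffAt (e.open_target.mem_nhds hy)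
  exact ((hX _).comp y h1).contDiffAt

theorem contDiffAt_transition [IsManifold (𝓡 n) ∞ M]
    (he : e ∈ IsManifold.maximalAtlas (𝓡 n) ∞ M) (he' : e' ∈ IsManifold.maximalAtlas (𝓡 n) ∞ M)
    {w : EuclideanSpace ℝ (Fin n)} (hw : w ∈ (e'.symm.trans e).source) :
    ContDiffAt ℝ ∞ (e ∘ e'.symm) w := by
  simp only [OpenPartialHomeomorph.trans_source, OpenPartialHomeomorph.symm_source,
    Set.mem_inter_iff, Set.mem_preimage] at hw
  have h1 : ContMDiffAt (𝓡 n) (𝓡 n) ∞ e'.symm w :=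
    (contMDiffOn_symm_of_mem_maximalAtlas he').contMDiffAt (e'.open_target.mem_nhds hw.1)
  have h2 : ContMDiffAt (𝓡 n) (𝓡 n) ∞ e (e'.symm w) :=
    (contMDiffOn_of_mem_maximalAtlas he).contMDiffAt (e.open_source.mem_nhds hw.2)
  exact (h2.comp w h1).contDiffAt

theorem fderiv_mem_tangentPlane [IsManifold (𝓡 n) ∞ M] (hX : ContMDiff (𝓡 n) (𝓡 m) ∞ X)
    (he : e ∈ IsManifold.maximalAtlas (𝓡 n) ∞ M) (hx : x ∈ e.source)
    (v : EuclideanSpace ℝ (Fin n)) :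
    fderiv ℝ (X ∘ e.symm) (e x) v ∈ tangentPlane (n := n) X x := by
  have hy : e x ∈ e.target := e.map_source hx
  have h1 : ContMDiffAt (𝓡 n) (𝓡 n) ∞ e.symm (e x) :=
    (contMDiffOn_symm_of_mem_maximalAtlas he).contMDiffAt (e.open_target.mem_nhds hy)
  have h2 : mfderiv (𝓡 n) (𝓡 m) (X ∘ e.symm) (e x) =
      (mfderiv (𝓡 n) (𝓡 m) X (e.symm (e x))).comp (mfderiv (𝓡 n) (𝓡 n) e.symm (e x)) :=
    mfderiv_comp _ ((hX _).mdifferentiableAt (by simp)) (h1.mdifferentiableAt (by simp))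
  rw [mfderiv_eq_fderiv, e.left_inv hx] at h2
  exact ⟨mfderiv (𝓡 n) (𝓡 n) e.symm (e x) v, by rw [h2]; rfl⟩

theorem normalPart_of_mem {v : EuclideanSpace ℝ (Fin m)}
    (hv : v ∈ tangentPlane (n := n) X x) : normalPart (n := n) X x v = 0 := by
  unfold normalPart
  rw [Submodule.starProjection_apply_eq_zero_iff]
  exact Submodule.le_orthogonal_orthogonal _ hv

theorem sum_conj_smul {E : Type*} [AddCommGroup E] [Module ℝ E] (J A : Matrix (Fin n) (Fin n) ℝ)
    (S : Fin n → Fin n → E) :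
    ∑ i, ∑ j, (J * A * J.transpose) i j • S i j =
      ∑ a, ∑ b, A a b • ∑ i, ∑ j, (J i a * J j b) • S i j := by
  simp only [Matrix.mul_apply, Matrix.transpose_apply, Finset.sum_mul, Finset.sum_smul,
    Finset.smul_sum, smul_smul]
  simp only [← Finset.sum_product']
  refine Finset.sum_nbij' (fun q => (q.2.2.2, q.2.2.1, q.1, q.2.1))
    (fun q => (q.2.2.1, q.2.2.2, q.2.1, q.1)) ?_ ?_ ?_ ?_ ?_ <;> simp
  intros
  congr 1
  ring

/-- The mean curvature vector does not depend on the chart used to compute it. -/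
theorem meanCurvatureInChart_eq [IsManifold (𝓡 n) ∞ M] (hX : ContMDiff (𝓡 n) (𝓡 m) ∞ X)
    (he : e ∈ IsManifold.maximalAtlas (𝓡 n) ∞ M) (he' : e' ∈ IsManifold.maximalAtlas (𝓡 n) ∞ M)
    (hx : x ∈ e.source) (hx' : x ∈ e'.source) :
    meanCurvatureInChart X e x = meanCurvatureInChart X e' x := by
  set φ : EuclideanSpace ℝ (Fin n) → EuclideanSpace ℝ (Fin n) := e ∘ e'.symm with hφ
  set f := X ∘ e.symm with hf
  set f' := X ∘ e'.symm with hf'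
  set z := e' x with hz
  have hzt : z ∈ e'.target := e'.map_source hx'
  have hφz : φ z = e x := by simp [hφ, hz, e'.left_inv hx']
  have hS : ∀ᶠ w in nhds z, w ∈ (e'.symm.trans e).source :=
    (e'.symm.trans e).open_source.mem_nhds ⟨hzt, by simp [hz, e'.left_inv hx', hx]⟩
  have hφs : ∀ w ∈ (e'.symm.trans e).source, ContDiffAt ℝ ∞ φ w :=
    fun w hw => contDiffAt_transition he he' hw
  have hff : ∀ w ∈ (e'.symm.trans e).source, f' w = (f ∘ φ) w := by
    intro w hw
    simp only [OpenPartialHomeomorph.trans_source, OpenPartialHomeomorph.symm_source,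
      Set.mem_inter_iff, Set.mem_preimage] at hw
    simp [hf, hf', hφ, e.left_inv hw.2]
  have hfs : ∀ w ∈ (e'.symm.trans e).source, ContDiffAt ℝ ∞ f (φ w) := by
    intro w hw
    simp only [OpenPartialHomeomorph.trans_source, OpenPartialHomeomorph.symm_source,
      Set.mem_inter_iff, Set.mem_preimage] at hw
    exact contDiffAt_comp_symm hX he (e.map_source hw.2)
  have hD : ∀ w ∈ (e'.symm.trans e).source,
      fderiv ℝ f' w = (fderiv ℝ f (φ w)).comp (fderiv ℝ φ w) := by
    intro w hw
    have : f' =ᶠ[nhds w] f ∘ φ :=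
      Filter.eventuallyEq_of_mem ((e'.symm.trans e).open_source.mem_nhds hw) hff
    rw [this.fderiv_eq]
    exact fderiv_comp w ((hfs w hw).differentiableAt (by simp))
      ((hφs w hw).differentiableAt (by simp))
  have hzS := hS.self_of_nhds
  -- the second derivative, up to a tangent vector
  have hDD : ∀ u v, fderiv ℝ (fderiv ℝ f') z u v =
      fderiv ℝ (fderiv ℝ f) (φ z) (fderiv ℝ φ z u) (fderiv ℝ φ z v) +
        fderiv ℝ f (φ z) (fderiv ℝ (fderiv ℝ φ) z u v) := by
    intro u v
    have h0 : fderiv ℝ f' =ᶠ[nhds z] fun w => (fderiv ℝ f (φ w)).comp (fderiv ℝ φ w) :=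
      hS.mono hD
    have hφ1 : DifferentiableAt ℝ (fderiv ℝ φ) z :=
      ((hφs z hzS).fderiv_right (m := 1) (by norm_cast)).differentiableAt (by simp)
    have hf1 : DifferentiableAt ℝ (fderiv ℝ f) (φ z) :=
      ((hfs z hzS).fderiv_right (m := 1) (by norm_cast)).differentiableAt (by simp)
    have hφ0 : DifferentiableAt ℝ φ z := (hφs z hzS).differentiableAt (by simp)
    have h1 : HasFDerivAt (fun w => fderiv ℝ f (φ w))
        ((fderiv ℝ (fderiv ℝ f) (φ z)).comp (fderiv ℝ φ z)) z :=
      hf1.hasFDerivAt.comp z hφ0.hasFDerivAt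
    rw [h0.fderiv_eq, (h1.clm_comp hφ1.hasFDerivAt).fderiv]
    simp [add_comm]
  set J : Matrix (Fin n) (Fin n) ℝ :=
    Matrix.of fun k i => fderiv ℝ φ z (EuclideanSpace.single i 1) k with hJ
  have hφe : ∀ i, fderiv ℝ φ z (EuclideanSpace.single i 1) =
      ∑ k, J k i • EuclideanSpace.single k (1 : ℝ) := by
    intro i
    ext k
    simp [hJ, Finset.sum_apply, Pi.single_apply]
  have hG : metricMatrix X e' z = J.transpose * metricMatrix X e (φ z) * J := by
    ext i j
    simp only [metricMatrix, Matrix.of_apply, Matrix.mul_apply, Matrix.transpose_apply]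
    rw [← hf', ← hf, hD z hzS]
    simp only [ContinuousLinearMap.comp_apply, hφe, map_sum, map_smul, sum_inner, inner_sum,
      inner_smul_left, inner_smul_right, Finset.sum_mul, conj_trivial]
    refine Finset.sum_congr rfl fun a _ => ?_
    rw [Finset.mul_sum]
    refine Finset.sum_congr rfl fun b _ => ?_
    rw [real_inner_comm]
    ring
  have hII : ∀ i j, secondFundamentalForm X e' x i j =
      ∑ k, ∑ l, (J k i * J l j) • secondFundamentalForm X e x k l := by
    intro i j
    have ht : normalPart (n := n) X x
        (fderiv ℝ f (φ z) (fderiv ℝ (fderiv ℝ φ) z (EuclideanSpace.single i 1)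
          (EuclideanSpace.single j 1))) = 0 := by
      rw [hφz]; exact normalPart_of_mem (fderiv_mem_tangentPlane hX he hx _)
    unfold normalPart at ht
    unfold secondFundamentalForm normalPart
    rw [← hf', ← hf, ← hz, hDD, map_add, ht, add_zero, hφz, hφe, hφe]
    simp only [map_sum, map_smul, sum_apply, smul_apply,
      Finset.smul_sum, smul_smul]
    rw [Finset.sum_comm]
    exact Finset.sum_congr rfl fun a _ => Finset.sum_congr rfl fun b _ => by rw [mul_comm]
  have hJu : IsUnit J.det := by
    have hxe : e x ∈ (e.symm.trans e').source := ⟨e.map_source hx, by simp [e.left_inv hx, hx']⟩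
    have hψ : DifferentiableAt ℝ (e' ∘ e.symm) (φ z) := by
      rw [hφz]; exact (contDiffAt_transition he' he hxe).differentiableAt (by simp)
    have hid : (e' ∘ e.symm) ∘ φ =ᶠ[nhds z] id := hS.mono fun w hw => by
      simp only [OpenPartialHomeomorph.trans_source, OpenPartialHomeomorph.symm_source,
        Set.mem_inter_iff, Set.mem_preimage] at hw
      simp [hφ, e.left_inv hw.2, e'.right_inv hw.1]
    have hc := hid.fderiv_eq (𝕜 := ℝ)
    rw [fderiv_comp z hψ ((hφs z hzS).differentiableAt (by simp)), fderiv_id] at hc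
    refine Matrix.isUnit_det_of_left_inverse (B := Matrix.of fun k i =>
      fderiv ℝ (e' ∘ e.symm) (φ z) (EuclideanSpace.single i 1) k) ?_
    ext i j
    have h1 : (fderiv ℝ (e' ∘ e.symm) (φ z) (fderiv ℝ φ z (EuclideanSpace.single j 1))) i =
        (EuclideanSpace.single j (1 : ℝ) : EuclideanSpace ℝ (Fin n)) i := by
      rw [← ContinuousLinearMap.comp_apply, hc]; rfl
    rw [hφe, map_sum] at h1
    simp only [map_smul] at h1
    simpa [Matrix.mul_apply, Matrix.one_apply, Pi.single_apply, mul_comm] using h1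
  have hinv : (metricMatrix X e (φ z))⁻¹ = J * (metricMatrix X e' z)⁻¹ * J.transpose := by
    rw [hG, Matrix.mul_inv_rev, Matrix.mul_inv_rev]
    have h1 : J * J⁻¹ = 1 := Matrix.mul_nonsing_inv _ hJu
    have h2 : (J.transpose)⁻¹ * J.transpose = 1 :=
      Matrix.nonsing_inv_mul _ (by rwa [Matrix.det_transpose])
    calc _ = (J * J⁻¹) * (metricMatrix X e (φ z))⁻¹ * ((J.transpose)⁻¹ * J.transpose) := by
            rw [h1, h2]; simp
      _ = _ := by simp only [Matrix.mul_assoc]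
  unfold meanCurvatureInChart
  rw [← hφz, hinv, ← hz]
  simp only [hII]
  exact sum_conj_smul J _ _

end Charts

/-- The mean curvature vector `H` (the unnormalized trace of the second fundamental form) at `x`.
It is computed in the preferred chart at `x`; by `meanCurvatureInChart_eq`, every other smooth
chart around `x` gives the same vector. -/
noncomputable def meanCurvature (X : M → EuclideanSpace ℝ (Fin m)) (x : M) :
    EuclideanSpace ℝ (Fin m) :=
  meanCurvatureInChart X (chartAt (EuclideanSpace ℝ (Fin n)) x) x

/-- `X : M → ℝᵐ` is a self-shrinker: a smooth immersion with `H = -X^N`. -/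
structure IsSelfShrinker (X : M → EuclideanSpace ℝ (Fin m)) : Prop where
  smooth : ContMDiff (𝓡 n) (𝓡 m) ∞ X
  immersion : ∀ x, Function.Injective (mfderiv (𝓡 n) (𝓡 m) X x)
  shrinker : ∀ x, meanCurvature (n := n) X x = -normalPart (n := n) X x (X x)

/-- The Riemannian measure `√(det g_ij) dy` of the induced metric on the domain of the chart `e`,
as a measure on `M` (zero outside of the domain of `e`). -/
noncomputable def chartVolume [MeasurableSpace M] (X : M → EuclideanSpace ℝ (Fin m))
    (e : OpenPartialHomeomorph M (EuclideanSpace ℝ (Fin n))) : MeasureTheory.Measure M :=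
  MeasureTheory.Measure.map e.symm
    ((MeasureTheory.volume.restrict e.target).withDensity
      fun y => ENNReal.ofReal (Real.sqrt (metricMatrix X e y).det))

/-- The Riemannian measure `dv` of the induced metric. On the domain of each smooth chart it is
`√(det g_ij) dy`; as these measures agree on overlaps, their least upper bound glues them. -/
noncomputable def riemVolume [MeasurableSpace M] (X : M → EuclideanSpace ℝ (Fin m)) :
    MeasureTheory.Measure M :=
  ⨆ e ∈ IsManifold.maximalAtlas (𝓡 n) ∞ M, chartVolume (n := n) X e

end Submfd

/-! On an immersed submanifold, the tangential part of the position vector satisfies `div X^T = n +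
⟨X^N, H⟩`, which is `n - |X^N|²` on a self-shrinker. Hence `div (φ X^T) = dφ(X^T) + φ (n - |X^N|²)`
integrates to zero over the compact `M` for every smooth `φ`. Taking `φ = 1` gives `∫ (n - |X^N|²) =
0`, so `|X^N|² < n` cannot hold everywhere. Taking `φ = exp(-|X|²/2)` gives `dφ(X^T) = -φ |X^T|²`,
and Pythagoras turns the divergence into `φ (n - |X|²)`. So `n` is the Gaussian average of `|X|²`,
which is at least the minimum. The divergence formula is proved in coordinates
(`sum_fderiv_mul_volumeDensity_mul_tangentCoord`), and the shrinker equation enters through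
`inner_normalPart_eq_neg`. Since `riemVolume_restrict_source` identifies the measure in every chart,
a partition of unity reduces `integral_weightedDivergence` to compactly supported fields on open
subsets of Euclidean space. -/

/-! ### Calculus of determinants and inverse matrices. -/

/-- **Jacobi's formula** for the derivative of a determinant. -/
theorem hasFDerivAt_matrix_det {ι E : Type*} [Fintype ι] [DecidableEq ι] [NormedAddCommGroup E]
    [NormedSpace ℝ E] {A : E → Matrix ι ι ℝ} {A' : ι → ι → E →L[ℝ] ℝ} {x : E}
    (hA : ∀ i j, HasFDerivAt (fun y => A y i j) (A' i j) x) :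
    HasFDerivAt (fun y => (A y).det) (∑ i, ∑ j, (A x).adjugate i j • A' j i) x := by
  have h1 : HasFDerivAt (fun y => (A y).det)
      (∑ σ : Equiv.Perm ι, ((Equiv.Perm.sign σ : ℤ) : ℝ) •
        ∑ i, (∏ j ∈ Finset.univ.erase i, A x (σ j) j) • A' (σ i) i) x := by
    simp only [Matrix.det_apply']
    exact HasFDerivAt.fun_sum fun σ _ =>
      (HasFDerivAt.finsetProd fun i _ => hA (σ i) i).const_mul _
  convert h1 using 1
  ext v
  simp only [sum_apply, smul_apply, smul_eq_mul, Finset.mul_sum]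
  rw [Finset.sum_comm (s := (Finset.univ : Finset (Equiv.Perm ι)))]
  refine Finset.sum_congr rfl fun i _ => ?_
  -- By Cramer's rule this sum is the determinant of `A x` with column `i` replaced by its
  -- derivative, which is the Leibniz sum with factor `i` differentiated.
  have h2 : ∑ j, (A x).adjugate i j * A' j i v = ((A x).cramer fun j => A' j i v) i := by
    rw [Matrix.cramer_eq_adjugate_mulVec]; rfl
  rw [h2, Matrix.cramer_apply, Matrix.det_apply']
  refine Finset.sum_congr rfl fun σ _ => ?_
  rw [← Finset.mul_prod_erase _ _ (Finset.mem_univ i), Matrix.updateCol_self]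
  rw [Finset.prod_congr rfl fun j hj =>
    Matrix.updateCol_ne (M := A x) (c := fun j => A' j i v) (i := σ j) (Finset.ne_of_mem_erase hj)]
  ring

theorem contDiffAt_matrix_det {ι E : Type*} [Fintype ι] [DecidableEq ι] [NormedAddCommGroup E]
    [NormedSpace ℝ E] {A : E → Matrix ι ι ℝ} {x : E} {k : ℕ∞ω}
    (hA : ∀ i j, ContDiffAt ℝ k (fun y => A y i j) x) :
    ContDiffAt ℝ k (fun y => (A y).det) x := by
  simp only [Matrix.det_apply']
  exact ContDiffAt.sum fun σ _ => contDiffAt_const.mul (contDiffAt_prod fun i _ => hA _ _)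

theorem contDiffAt_matrix_inv {ι E : Type*} [Fintype ι] [DecidableEq ι] [NormedAddCommGroup E]
    [NormedSpace ℝ E] {A : E → Matrix ι ι ℝ} {x : E} {k : ℕ∞ω}
    (hA : ∀ i j, ContDiffAt ℝ k (fun y => A y i j) x) (hx : (A x).det ≠ 0) (i j : ι) :
    ContDiffAt ℝ k (fun y => (A y)⁻¹ i j) x := by
  simp only [Matrix.inv_def, Ring.inverse_eq_inv', Matrix.smul_apply, smul_eq_mul,
    Matrix.adjugate_apply]
  refine ((contDiffAt_matrix_det hA).inv hx).mul (contDiffAt_matrix_det fun a b => ?_)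
  simp only [Matrix.updateRow_apply]
  split_ifs
  · exact contDiffAt_const
  · exact hA _ _

/-! ### First-order geometry in a chart: metric, density, tangential part of `X`. -/

namespace Submfd

variable {n m : ℕ} {M : Type*} [TopologicalSpace M]

/-- The density `√(det g_ij)` of the Riemannian measure in the chart `e`. -/
noncomputable def volumeDensity (X : M → EuclideanSpace ℝ (Fin m))
    (e : OpenPartialHomeomorph M (EuclideanSpace ℝ (Fin n))) (y : EuclideanSpace ℝ (Fin n)) : ℝ :=
  Real.sqrt (metricMatrix X e y).det

/-- The coordinates `∑ g^{ij} ⟨X, ∂_j X⟩` in the chart `e` of the tangential part of `X`. -/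
noncomputable def tangentCoord (X : M → EuclideanSpace ℝ (Fin m))
    (e : OpenPartialHomeomorph M (EuclideanSpace ℝ (Fin n))) (y : EuclideanSpace ℝ (Fin n)) :
    EuclideanSpace ℝ (Fin n) :=
  WithLp.toLp 2 ((metricMatrix X e y)⁻¹.mulVec fun j =>
    inner ℝ ((X ∘ e.symm) y) (fderiv ℝ (X ∘ e.symm) y (EuclideanSpace.single j 1)))

section Local

variable {X : M → EuclideanSpace ℝ (Fin m)}
  {e : OpenPartialHomeomorph M (EuclideanSpace ℝ (Fin n))} {y : EuclideanSpace ℝ (Fin n)}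

theorem sum_smul_single (v : EuclideanSpace ℝ (Fin n)) :
    ∑ i, v i • EuclideanSpace.single i (1 : ℝ) = v := by
  ext k
  simp [Finset.sum_apply, Pi.single_apply]

theorem map_eq_sum {F : Type*} [NormedAddCommGroup F] [NormedSpace ℝ F]
    (L : EuclideanSpace ℝ (Fin n) →L[ℝ] F) (v : EuclideanSpace ℝ (Fin n)) :
    L v = ∑ i, v i • L (EuclideanSpace.single i 1) := by
  conv_lhs => rw [← sum_smul_single v]
  simp [map_sum]

theorem metricMatrix_posDef (hi : Function.Injective (fderiv ℝ (X ∘ e.symm) y)) :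
    (metricMatrix X e y).PosDef := by
  refine Matrix.posDef_gram_of_linearIndependent (𝕜 := ℝ)
    (v := fun i : Fin n => fderiv ℝ (X ∘ e.symm) y (EuclideanSpace.single i 1)) ?_
  have h := (EuclideanSpace.basisFun (Fin n) ℝ).toBasis.linearIndependent.map'
    (fderiv ℝ (X ∘ e.symm) y).toLinearMap (LinearMap.ker_eq_bot.2 hi)
  have hv : (fun i : Fin n => fderiv ℝ (X ∘ e.symm) y (EuclideanSpace.single i 1)) =
      (fderiv ℝ (X ∘ e.symm) y).toLinearMap ∘ (EuclideanSpace.basisFun (Fin n) ℝ).toBasis := by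
    ext1 i
    simp
  rw [hv]
  exact h

theorem metricMatrix_det_pos (hi : Function.Injective (fderiv ℝ (X ∘ e.symm) y)) :
    0 < (metricMatrix X e y).det :=
  (metricMatrix_posDef hi).det_pos

theorem metricMatrix_symm (i j : Fin n) : metricMatrix X e y i j = metricMatrix X e y j i := by
  simp only [metricMatrix, Matrix.of_apply, real_inner_comm]

theorem metricMatrix_inv_symm (i j : Fin n) :
    (metricMatrix X e y)⁻¹ i j = (metricMatrix X e y)⁻¹ j i := by
  have h : (metricMatrix X e y).transpose = metricMatrix X e y := by
    ext i j; exact metricMatrix_symm _ _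
  conv_rhs => rw [← h, ← Matrix.transpose_nonsing_inv]
  rfl

theorem contDiffAt_fderiv_apply (hf : ContDiffAt ℝ ∞ (X ∘ e.symm) y)
    (v : EuclideanSpace ℝ (Fin n)) : ContDiffAt ℝ ∞ (fun z => fderiv ℝ (X ∘ e.symm) z v) y :=
  (hf.fderiv_right (m := ∞) (by simp)).clm_apply contDiffAt_const

theorem contDiffAt_metricMatrix (hf : ContDiffAt ℝ ∞ (X ∘ e.symm) y) (i j : Fin n) :
    ContDiffAt ℝ ∞ (fun z => metricMatrix X e z i j) y :=
  (contDiffAt_fderiv_apply hf _).inner ℝ (contDiffAt_fderiv_apply hf _)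

theorem contDiffAt_volumeDensity (hf : ContDiffAt ℝ ∞ (X ∘ e.symm) y)
    (hi : Function.Injective (fderiv ℝ (X ∘ e.symm) y)) :
    ContDiffAt ℝ ∞ (volumeDensity X e) y :=
  (contDiffAt_matrix_det (contDiffAt_metricMatrix hf)).sqrt (metricMatrix_det_pos hi).ne'

theorem volumeDensity_pos (hi : Function.Injective (fderiv ℝ (X ∘ e.symm) y)) :
    0 < volumeDensity X e y :=
  Real.sqrt_pos.2 (metricMatrix_det_pos hi)

theorem contDiffAt_tangentCoord (hf : ContDiffAt ℝ ∞ (X ∘ e.symm) y)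
    (hi : Function.Injective (fderiv ℝ (X ∘ e.symm) y)) :
    ContDiffAt ℝ ∞ (tangentCoord X e) y := by
  rw [contDiffAt_euclidean]
  intro i
  simp only [tangentCoord, Matrix.mulVec, dotProduct]
  exact ContDiffAt.sum fun j _ =>
    (contDiffAt_matrix_inv (contDiffAt_metricMatrix hf) (metricMatrix_det_pos hi).ne' i j).mul
      (hf.inner ℝ (contDiffAt_fderiv_apply hf _))

/-- This inverse-free form `g w = ⟨X, ∂X⟩` is the one differentiated later, so that no derivative of
`g⁻¹` is ever needed. -/
theorem sum_metricMatrix_mul_tangentCoord (hi : Function.Injective (fderiv ℝ (X ∘ e.symm) y))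
    (i : Fin n) : ∑ j, metricMatrix X e y i j * tangentCoord X e y j =
      inner ℝ ((X ∘ e.symm) y) (fderiv ℝ (X ∘ e.symm) y (EuclideanSpace.single i 1)) := by
  have h : (metricMatrix X e y).mulVec ((metricMatrix X e y)⁻¹.mulVec fun j =>
      inner ℝ ((X ∘ e.symm) y) (fderiv ℝ (X ∘ e.symm) y (EuclideanSpace.single j 1))) =
      fun j => inner ℝ ((X ∘ e.symm) y)
        (fderiv ℝ (X ∘ e.symm) y (EuclideanSpace.single j 1)) := by
    rw [Matrix.mulVec_mulVec, Matrix.mul_nonsing_inv _ (metricMatrix_det_pos hi).ne'.isUnit,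
      Matrix.one_mulVec]
  exact congrFun h i

/-- The normal equations: `X - dX(w)` is normal, where `w` are the coordinates of the tangential
part. -/
theorem inner_sub_fderiv_tangentCoord (hi : Function.Injective (fderiv ℝ (X ∘ e.symm) y))
    (v : EuclideanSpace ℝ (Fin n)) :
    inner ℝ ((X ∘ e.symm) y - fderiv ℝ (X ∘ e.symm) y (tangentCoord X e y))
      (fderiv ℝ (X ∘ e.symm) y v) = 0 := by
  rw [map_eq_sum _ v, inner_sum]
  refine Finset.sum_eq_zero fun i _ => ?_
  rw [inner_smul_right, inner_sub_left, ← sum_metricMatrix_mul_tangentCoord hi i,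
    map_eq_sum _ (tangentCoord X e y), sum_inner, sub_eq_zero.2, mul_zero]
  refine Finset.sum_congr rfl fun j _ => ?_
  rw [inner_smul_left, metricMatrix_symm, mul_comm]
  rfl

theorem hasFDerivAt_fderiv_apply (hf : ContDiffAt ℝ ∞ (X ∘ e.symm) y)
    (v : EuclideanSpace ℝ (Fin n)) :
    HasFDerivAt (fun z => fderiv ℝ (X ∘ e.symm) z v)
      ((fderiv ℝ (fderiv ℝ (X ∘ e.symm)) y).flip v) y := by
  have h : HasFDerivAt (fderiv ℝ (X ∘ e.symm)) (fderiv ℝ (fderiv ℝ (X ∘ e.symm)) y) y :=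
    ((hf.fderiv_right (m := 1) (by norm_cast)).differentiableAt (by simp)).hasFDerivAt
  refine (h.clm_apply (hasFDerivAt_const v y)).congr_fderiv ?_
  ext1 u
  simp

theorem fderiv_metricMatrix_apply (hf : ContDiffAt ℝ ∞ (X ∘ e.symm) y) (i j : Fin n)
    (v : EuclideanSpace ℝ (Fin n)) :
    fderiv ℝ (fun z => metricMatrix X e z i j) y v =
      inner ℝ (fderiv ℝ (fderiv ℝ (X ∘ e.symm)) y v (EuclideanSpace.single i 1))
        (fderiv ℝ (X ∘ e.symm) y (EuclideanSpace.single j 1)) +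
      inner ℝ (fderiv ℝ (X ∘ e.symm) y (EuclideanSpace.single i 1))
        (fderiv ℝ (fderiv ℝ (X ∘ e.symm)) y v (EuclideanSpace.single j 1)) := by
  have h := (hasFDerivAt_fderiv_apply hf (EuclideanSpace.single i 1)).inner ℝ
    (hasFDerivAt_fderiv_apply hf (EuclideanSpace.single j 1))
  rw [show (fun z => metricMatrix X e z i j) = fun z =>
    inner ℝ (fderiv ℝ (X ∘ e.symm) z (EuclideanSpace.single i 1))
      (fderiv ℝ (X ∘ e.symm) z (EuclideanSpace.single j 1)) from rfl, h.fderiv]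
  simp [add_comm]

/-- Jacobi's formula with `adj g = det g • g⁻¹` gives `½ √(det g) g^{ij} ∂_v g_ij`. The product rule
splits `∂_v g_ij` into two terms with equal contractions, by symmetry of `g⁻¹`, and this absorbs the
`½`. -/
theorem fderiv_volumeDensity_apply (hf : ContDiffAt ℝ ∞ (X ∘ e.symm) y)
    (hi : Function.Injective (fderiv ℝ (X ∘ e.symm) y)) (v : EuclideanSpace ℝ (Fin n)) :
    fderiv ℝ (volumeDensity X e) y v =
      volumeDensity X e y * ∑ i, ∑ j, (metricMatrix X e y)⁻¹ i j *
        inner ℝ (fderiv ℝ (X ∘ e.symm) y (EuclideanSpace.single i 1))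
          (fderiv ℝ (fderiv ℝ (X ∘ e.symm)) y v (EuclideanSpace.single j 1)) := by
  have hpos := metricMatrix_det_pos hi
  have hd := (hasFDerivAt_matrix_det fun i j =>
    ((contDiffAt_metricMatrix hf i j).differentiableAt (by simp)).hasFDerivAt).sqrt hpos.ne'
  have hadj : (metricMatrix X e y).adjugate =
      (metricMatrix X e y).det • (metricMatrix X e y)⁻¹ := by
    rw [Matrix.inv_def, smul_smul, Ring.inverse_eq_inv', mul_inv_cancel₀ hpos.ne', one_smul]
  have hsw : ∑ i, ∑ j, (metricMatrix X e y)⁻¹ i j *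
      inner ℝ (fderiv ℝ (fderiv ℝ (X ∘ e.symm)) y v (EuclideanSpace.single j 1))
        (fderiv ℝ (X ∘ e.symm) y (EuclideanSpace.single i 1)) =
      ∑ i, ∑ j, (metricMatrix X e y)⁻¹ i j *
      inner ℝ (fderiv ℝ (X ∘ e.symm) y (EuclideanSpace.single i 1))
        (fderiv ℝ (fderiv ℝ (X ∘ e.symm)) y v (EuclideanSpace.single j 1)) := by
    simp_rw [real_inner_comm]
  have hsw' : ∑ i, ∑ j, (metricMatrix X e y)⁻¹ i j *
      inner ℝ (fderiv ℝ (X ∘ e.symm) y (EuclideanSpace.single j 1))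
        (fderiv ℝ (fderiv ℝ (X ∘ e.symm)) y v (EuclideanSpace.single i 1)) =
      ∑ i, ∑ j, (metricMatrix X e y)⁻¹ i j *
      inner ℝ (fderiv ℝ (X ∘ e.symm) y (EuclideanSpace.single i 1))
        (fderiv ℝ (fderiv ℝ (X ∘ e.symm)) y v (EuclideanSpace.single j 1)) := by
    rw [Finset.sum_comm]
    simp_rw [metricMatrix_inv_symm (X := X)]
  rw [show volumeDensity X e = fun z => Real.sqrt (metricMatrix X e z).det from rfl, hd.fderiv,
    hadj]
  simp only [smul_apply, sum_apply, fderiv_metricMatrix_apply hf, Matrix.smul_apply, smul_eq_mul,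
    mul_assoc, mul_add, Finset.sum_add_distrib, ← Finset.mul_sum]
  rw [hsw, hsw']
  have hs := Real.mul_self_sqrt hpos.le
  have hs0 := (Real.sqrt_pos.2 hpos).ne'
  field_simp
  rw [sq, hs]
  ring

end Local

end Submfd

/-! ### The divergence of `φ X^T` in coordinates. -/

namespace Submfd

variable {n m : ℕ} {M : Type*} [TopologicalSpace M]
variable {X : M → EuclideanSpace ℝ (Fin m)}
  {e : OpenPartialHomeomorph M (EuclideanSpace ℝ (Fin n))} {y : EuclideanSpace ℝ (Fin n)}

/-- Both sides of `g w = ⟨X, ∂_i X⟩` are differentiated by the product rule. Injectivity is required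
near `y` because the identity must hold on a neighbourhood. -/
theorem fderiv_tangentCoord_apply (hf : ContDiffAt ℝ ∞ (X ∘ e.symm) y)
    (hi : ∀ᶠ z in nhds y, Function.Injective (fderiv ℝ (X ∘ e.symm) z)) (i : Fin n)
    (v : EuclideanSpace ℝ (Fin n)) :
    ∑ j, metricMatrix X e y i j * fderiv ℝ (fun z => tangentCoord X e z j) y v =
      inner ℝ (fderiv ℝ (X ∘ e.symm) y (EuclideanSpace.single i 1))
        (fderiv ℝ (X ∘ e.symm) y v) +
      inner ℝ ((X ∘ e.symm) y)
        (fderiv ℝ (fderiv ℝ (X ∘ e.symm)) y v (EuclideanSpace.single i 1)) -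
      ∑ j, tangentCoord X e y j * fderiv ℝ (fun z => metricMatrix X e z i j) y v := by
  have hw : ∀ j, HasFDerivAt (fun z => tangentCoord X e z j)
      (fderiv ℝ (fun z => tangentCoord X e z j) y) y := fun j =>
    ((contDiffAt_euclidean.1 (contDiffAt_tangentCoord hf hi.self_of_nhds) j).differentiableAt
      (by simp)).hasFDerivAt
  have hg : ∀ j, HasFDerivAt (fun z => metricMatrix X e z i j)
      (fderiv ℝ (fun z => metricMatrix X e z i j) y) y := fun j =>
    ((contDiffAt_metricMatrix hf i j).differentiableAt (by simp)).hasFDerivAt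
  have h1 := HasFDerivAt.fun_sum (u := Finset.univ) fun j _ => (hg j).mul (hw j)
  have h2 := (hf.differentiableAt (by simp)).hasFDerivAt.inner ℝ
    (hasFDerivAt_fderiv_apply hf (EuclideanSpace.single i 1))
  have h3 := h2.congr_of_eventuallyEq (hi.mono fun z hz => sum_metricMatrix_mul_tangentCoord hz i)
  have h4 := congrArg (fun L => L v) (h1.unique h3)
  simp only [sum_apply, add_apply, smul_apply, smul_eq_mul, ContinuousLinearMap.comp_apply,
    Finset.sum_add_distrib, ContinuousLinearMap.prod_apply, fderivInnerCLM_apply,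
    ContinuousLinearMap.flip_apply] at h4
  rw [real_inner_comm (fderiv ℝ (X ∘ e.symm) y v)]
  linarith

theorem sum_inv_metricMatrix_mul_sum (hi : Function.Injective (fderiv ℝ (X ∘ e.symm) y))
    (k : Fin n) (c : Fin n → ℝ) :
    ∑ i, (metricMatrix X e y)⁻¹ k i * ∑ j, metricMatrix X e y i j * c j = c k := by
  have h : (metricMatrix X e y)⁻¹.mulVec ((metricMatrix X e y).mulVec c) = c := by
    rw [Matrix.mulVec_mulVec, Matrix.nonsing_inv_mul _ (metricMatrix_det_pos hi).ne'.isUnit,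
      Matrix.one_mulVec]
  exact congrFun h k

/-- The left side is `div X^T`, its second sum being the logarithmic derivative of the density along
`w`. Solving the differentiated normal equations with `g⁻¹` produces the trace `g^{ki} g_ik = n`,
the terms pairing `∂∂X` with `X - dX(w)`, and a remainder that cancels the density term. -/
theorem sum_fderiv_tangentCoord (hf : ContDiffAt ℝ ∞ (X ∘ e.symm) y)
    (hi : ∀ᶠ z in nhds y, Function.Injective (fderiv ℝ (X ∘ e.symm) z)) :
    (∑ k, fderiv ℝ (fun z => tangentCoord X e z k) y (EuclideanSpace.single k 1)) +
      ∑ j, tangentCoord X e y j * ∑ k, ∑ i, (metricMatrix X e y)⁻¹ k i *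
        inner ℝ (fderiv ℝ (X ∘ e.symm) y (EuclideanSpace.single k 1))
          (fderiv ℝ (fderiv ℝ (X ∘ e.symm)) y (EuclideanSpace.single j 1)
            (EuclideanSpace.single i 1)) =
      n + inner ℝ ((X ∘ e.symm) y - fderiv ℝ (X ∘ e.symm) y (tangentCoord X e y))
        (∑ k, ∑ i, (metricMatrix X e y)⁻¹ k i •
          fderiv ℝ (fderiv ℝ (X ∘ e.symm)) y (EuclideanSpace.single k 1)
            (EuclideanSpace.single i 1)) := by
  have hi0 := hi.self_of_nhds
  have hsymm : IsSymmSndFDerivAt ℝ (X ∘ e.symm) y :=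
    hf.isSymmSndFDerivAt (by
      rw [minSmoothness_of_isRCLikeNormedField]; exact WithTop.coe_le_coe.2 le_top)
  set P := (metricMatrix X e y)⁻¹ with hP
  set w := tangentCoord X e y with hw
  set D : Fin n → EuclideanSpace ℝ (Fin m) := fun i =>
    fderiv ℝ (X ∘ e.symm) y (EuclideanSpace.single i 1) with hD
  set S : Fin n → Fin n → EuclideanSpace ℝ (Fin m) := fun k i =>
    fderiv ℝ (fderiv ℝ (X ∘ e.symm)) y (EuclideanSpace.single k 1)
      (EuclideanSpace.single i 1) with hS
  have hSs : ∀ k i, S k i = S i k := fun k i => hsymm.eq _ _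
  have hPs : ∀ k i, P k i = P i k := fun k i => metricMatrix_inv_symm k i
  have h1 : ∀ k, fderiv ℝ (fun z => tangentCoord X e z k) y (EuclideanSpace.single k 1) =
      ∑ i, P k i * (metricMatrix X e y i k + inner ℝ ((X ∘ e.symm) y) (S k i) -
        ∑ j, w j * (inner ℝ (S k i) (D j) + inner ℝ (D i) (S k j))) := by
    intro k
    rw [← sum_inv_metricMatrix_mul_sum hi0 k
      fun j => fderiv ℝ (fun z => tangentCoord X e z j) y (EuclideanSpace.single k 1)]
    refine Finset.sum_congr rfl fun i _ => ?_
    rw [fderiv_tangentCoord_apply hf hi]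
    simp only [fderiv_metricMatrix_apply hf]
    rfl
  have h2 : ∑ k, ∑ i, P k i * metricMatrix X e y i k = n := by
    have : P * metricMatrix X e y = 1 :=
      Matrix.nonsing_inv_mul _ (metricMatrix_det_pos hi0).ne'.isUnit
    calc _ = (P * metricMatrix X e y).trace := by simp [Matrix.trace, Matrix.mul_apply]
      _ = n := by rw [this]; simp
  -- The cancellation: the density term matches half of the derivative of the metric, using symmetry
  -- of `P` and of second derivatives.
  have h3 : ∑ j, w j * ∑ k, ∑ i, P k i * inner ℝ (D k) (S j i) =
      ∑ k, ∑ i, P k i * ∑ j, w j * inner ℝ (D i) (S k j) := by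
    simp only [Finset.mul_sum]
    rw [Finset.sum_comm]
    rw [Finset.sum_congr rfl fun k _ => Finset.sum_comm]
    rw [Finset.sum_comm]
    refine Finset.sum_congr rfl fun k _ => Finset.sum_congr rfl fun i _ =>
      Finset.sum_congr rfl fun j _ => ?_
    rw [hPs, hSs j]
    ring
  -- The other half of the derivative of the metric is what replaces `X` by its normal part.
  have h4 : inner ℝ ((X ∘ e.symm) y - fderiv ℝ (X ∘ e.symm) y w) (∑ k, ∑ i, P k i • S k i) =
      (∑ k, ∑ i, P k i * inner ℝ ((X ∘ e.symm) y) (S k i)) -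
        ∑ k, ∑ i, P k i * ∑ j, w j * inner ℝ (S k i) (D j) := by
    rw [map_eq_sum _ w]
    simp only [inner_sum, inner_smul_right, inner_sub_left, sum_inner, inner_smul_left,
      conj_trivial, mul_sub, Finset.sum_sub_distrib]
    simp only [hD, real_inner_comm]
  rw [h3, h4, Finset.sum_congr rfl fun k _ => h1 k]
  simp only [mul_sub, mul_add, Finset.sum_add_distrib, Finset.sum_sub_distrib]
  rw [h2]
  ring

/-- The divergence of `φ X^T` in local coordinates. -/
theorem sum_fderiv_mul_volumeDensity_mul_tangentCoord (hf : ContDiffAt ℝ ∞ (X ∘ e.symm) y)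
    (hi : ∀ᶠ z in nhds y, Function.Injective (fderiv ℝ (X ∘ e.symm) z))
    {φ : EuclideanSpace ℝ (Fin n) → ℝ} (hφ : DifferentiableAt ℝ φ y) :
    ∑ k, fderiv ℝ (fun z => φ z * (volumeDensity X e z * tangentCoord X e z k)) y
        (EuclideanSpace.single k 1) =
      volumeDensity X e y * (fderiv ℝ φ y (tangentCoord X e y) +
        φ y * (n + inner ℝ ((X ∘ e.symm) y - fderiv ℝ (X ∘ e.symm) y (tangentCoord X e y))
        (∑ k, ∑ i, (metricMatrix X e y)⁻¹ k i •
          fderiv ℝ (fderiv ℝ (X ∘ e.symm)) y (EuclideanSpace.single k 1)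
            (EuclideanSpace.single i 1)))) := by
  have hi0 := hi.self_of_nhds
  have hw : ∀ j, HasFDerivAt (fun z => tangentCoord X e z j)
      (fderiv ℝ (fun z => tangentCoord X e z j) y) y := fun j =>
    ((contDiffAt_euclidean.1 (contDiffAt_tangentCoord hf hi0) j).differentiableAt
      (by simp)).hasFDerivAt
  have hG := ((contDiffAt_volumeDensity hf hi0).differentiableAt (by simp)).hasFDerivAt
  have h := fun k => (hφ.hasFDerivAt.mul (hG.mul (hw k))).fderiv
  rw [← sum_fderiv_tangentCoord hf hi, map_eq_sum (fderiv ℝ φ y)]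
  simp only [smul_eq_mul, mul_add, Finset.mul_sum]
  rw [← Finset.sum_add_distrib, ← Finset.sum_add_distrib]
  refine Finset.sum_congr rfl fun k _ => ?_
  rw [show (fun z => φ z * (volumeDensity X e z * tangentCoord X e z k)) =
    φ * ((volumeDensity X e) * fun z => tangentCoord X e z k) from rfl, h]
  simp only [add_apply, smul_apply, smul_eq_mul, fderiv_volumeDensity_apply hf hi0,
    Pi.mul_apply, ← Finset.mul_sum]
  ring

end Submfd

/-! ### The Riemannian measure in charts. -/

namespace Submfd

open MeasureTheory

/-- `e.symm` is controlled only on the open set `e.target`, where it is continuous, so measurability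
is checked on that subtype and pushed forward. -/
theorem measurableSet_target_inter_preimage {α β : Type*} [TopologicalSpace α]
    [TopologicalSpace β] [MeasurableSpace α] [BorelSpace α] [MeasurableSpace β] [BorelSpace β]
    (e : OpenPartialHomeomorph α β) {A : Set α} (hA : MeasurableSet A) :
    MeasurableSet (e.target ∩ e.symm ⁻¹' A) := by
  have h : Measurable (e.target.domRestrict e.symm) :=
    (continuousOn_iff_continuous_domRestrict.1 e.continuousOn_symm).measurable
  have h2 := e.open_target.measurableSet.subtype_image (h hA)
  convert h2 using 1
  ext y
  simp [Set.domRestrict, and_comm]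

theorem aemeasurable_symm {n : ℕ} {M : Type*} [TopologicalSpace M] [MeasurableSpace M]
    [BorelSpace M] (e : OpenPartialHomeomorph M (EuclideanSpace ℝ (Fin n)))
    (f : EuclideanSpace ℝ (Fin n) → ENNReal) :
    AEMeasurable e.symm ((volume.restrict e.target).withDensity f) :=
  (e.continuousOn_symm.aemeasurable e.open_target.measurableSet).mono_ac
    (withDensity_absolutelyContinuous _ _)

section

variable {n m : ℕ} {M : Type*} [TopologicalSpace M] [MeasurableSpace M] [BorelSpace M]
  {X : M → EuclideanSpace ℝ (Fin m)} {e : OpenPartialHomeomorph M (EuclideanSpace ℝ (Fin n))}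

theorem chartVolume_apply {A : Set M} (hA : MeasurableSet A) :
    chartVolume X e A =
      ∫⁻ y in e.target ∩ e.symm ⁻¹' A, ENNReal.ofReal (volumeDensity X e y) := by
  rw [chartVolume, Measure.map_apply_of_aemeasurable (aemeasurable_symm _ _) hA,
    withDensity_apply', Measure.restrict_restrict' e.open_target.measurableSet, Set.inter_comm]
  rfl

theorem chartVolume_compl_source : chartVolume X e e.sourceᶜ = 0 := by
  rw [chartVolume_apply e.open_source.measurableSet.compl]
  have : e.target ∩ e.symm ⁻¹' e.sourceᶜ = ∅ := by
    ext y
    simp only [Set.mem_inter_iff, Set.mem_preimage, Set.mem_compl_iff, Set.mem_empty_iff_false,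
      iff_false, not_and, not_not]
    exact e.map_target
  rw [this, Measure.restrict_empty, lintegral_zero_measure]

end

variable {n m : ℕ} {M : Type*} [TopologicalSpace M] [ChartedSpace (EuclideanSpace ℝ (Fin n)) M]
  {X : M → EuclideanSpace ℝ (Fin m)} {e e' : OpenPartialHomeomorph M (EuclideanSpace ℝ (Fin n))}

theorem mdifferentiable_of_mem_maximalAtlas (he : e ∈ IsManifold.maximalAtlas (𝓡 n) ∞ M) :
    e.MDifferentiable (𝓡 n) (𝓡 n) :=
  ⟨(contMDiffOn_of_mem_maximalAtlas he).mdifferentiableOn (by simp),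
    (contMDiffOn_symm_of_mem_maximalAtlas he).mdifferentiableOn (by simp)⟩


theorem fderiv_comp_symm {k : ℕ} {Y : M → EuclideanSpace ℝ (Fin k)}
    (hY : ContMDiff (𝓡 n) (𝓡 k) ∞ Y)
    (he : e ∈ IsManifold.maximalAtlas (𝓡 n) ∞ M) {x : M} (hx : x ∈ e.source)
    (v : EuclideanSpace ℝ (Fin n)) :
    fderiv ℝ (Y ∘ e.symm) (e x) v =
      mfderiv (𝓡 n) (𝓡 k) Y x (mfderiv (𝓡 n) (𝓡 n) e.symm (e x) v) := by
  have hy : e x ∈ e.target := e.map_source hx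
  have h2 : mfderiv (𝓡 n) (𝓡 k) (Y ∘ e.symm) (e x) =
      (mfderiv (𝓡 n) (𝓡 k) Y (e.symm (e x))).comp (mfderiv (𝓡 n) (𝓡 n) e.symm (e x)) :=
    mfderiv_comp _ ((hY _).mdifferentiableAt (by simp))
      ((mdifferentiable_of_mem_maximalAtlas he).mdifferentiableAt_symm hy)
  rw [mfderiv_eq_fderiv, e.left_inv hx] at h2
  rw [h2]
  rfl

theorem fderiv_real_comp_symm {φ : M → ℝ} (hφ : ContMDiff (𝓡 n) 𝓘(ℝ, ℝ) ∞ φ)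
    (he : e ∈ IsManifold.maximalAtlas (𝓡 n) ∞ M) {x : M} (hx : x ∈ e.source)
    (v : EuclideanSpace ℝ (Fin n)) :
    fderiv ℝ (φ ∘ e.symm) (e x) v =
      mfderiv (𝓡 n) 𝓘(ℝ, ℝ) φ x (mfderiv (𝓡 n) (𝓡 n) e.symm (e x) v) := by
  have hy : e x ∈ e.target := e.map_source hx
  have h2 : mfderiv (𝓡 n) 𝓘(ℝ, ℝ) (φ ∘ e.symm) (e x) =
      (mfderiv (𝓡 n) 𝓘(ℝ, ℝ) φ (e.symm (e x))).comp (mfderiv (𝓡 n) (𝓡 n) e.symm (e x)) :=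
    mfderiv_comp _ ((hφ _).mdifferentiableAt (by simp))
      ((mdifferentiable_of_mem_maximalAtlas he).mdifferentiableAt_symm hy)
  rw [mfderiv_eq_fderiv, e.left_inv hx] at h2
  rw [h2]
  rfl

theorem mfderiv_symm_bijective (he : e ∈ IsManifold.maximalAtlas (𝓡 n) ∞ M) {x : M}
    (hx : x ∈ e.source) :
    Function.Bijective (mfderiv (𝓡 n) (𝓡 n) e.symm (e x)) :=
  (mdifferentiable_of_mem_maximalAtlas he).symm.mfderiv_bijective (e.map_source hx)

theorem fderiv_comp_symm_injective (hX : ContMDiff (𝓡 n) (𝓡 m) ∞ X)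
    (hi : ∀ x, Function.Injective (mfderiv (𝓡 n) (𝓡 m) X x))
    (he : e ∈ IsManifold.maximalAtlas (𝓡 n) ∞ M) {y : EuclideanSpace ℝ (Fin n)}
    (hy : y ∈ e.target) : Function.Injective (fderiv ℝ (X ∘ e.symm) y) := by
  obtain ⟨x, hx, rfl⟩ : ∃ x ∈ e.source, e x = y := ⟨e.symm y, e.map_target hy, e.right_inv hy⟩
  intro u v huv
  rw [fderiv_comp_symm hX he hx, fderiv_comp_symm hX he hx] at huv
  exact (mfderiv_symm_bijective he hx).1 (@hi x _ _ huv)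

theorem eventually_fderiv_comp_symm_injective (hX : ContMDiff (𝓡 n) (𝓡 m) ∞ X)
    (hi : ∀ x, Function.Injective (mfderiv (𝓡 n) (𝓡 m) X x))
    (he : e ∈ IsManifold.maximalAtlas (𝓡 n) ∞ M) {y : EuclideanSpace ℝ (Fin n)}
    (hy : y ∈ e.target) : ∀ᶠ z in nhds y, Function.Injective (fderiv ℝ (X ∘ e.symm) z) :=
  Filter.eventually_of_mem (e.open_target.mem_nhds hy) fun _ hz =>
    fderiv_comp_symm_injective hX hi he hz

variable [IsManifold (𝓡 n) ∞ M]

theorem continuousOn_volumeDensity (hX : ContMDiff (𝓡 n) (𝓡 m) ∞ X)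
    (hi : ∀ x, Function.Injective (mfderiv (𝓡 n) (𝓡 m) X x))
    (he : e ∈ IsManifold.maximalAtlas (𝓡 n) ∞ M) :
    ContinuousOn (volumeDensity X e) e.target := fun _ hy =>
  (contDiffAt_volumeDensity (contDiffAt_comp_symm hX he hy)
    (fderiv_comp_symm_injective hX hi he hy)).continuousAt.continuousWithinAt

/-- The density of the Riemannian measure transforms by the Jacobian determinant. -/
theorem volumeDensity_transition (hX : ContMDiff (𝓡 n) (𝓡 m) ∞ X)
    (he : e ∈ IsManifold.maximalAtlas (𝓡 n) ∞ M) (he' : e' ∈ IsManifold.maximalAtlas (𝓡 n) ∞ M)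
    {z : EuclideanSpace ℝ (Fin n)} (hz : z ∈ (e'.symm.trans e).source) :
    volumeDensity X e' z =
      |(fderiv ℝ (e ∘ e'.symm) z).det| * volumeDensity X e ((e ∘ e'.symm) z) := by
  have hzt : z ∈ e'.target ∧ e'.symm z ∈ e.source := by simpa using hz
  have hD : fderiv ℝ (X ∘ e'.symm) z =
      (fderiv ℝ (X ∘ e.symm) ((e ∘ e'.symm) z)).comp (fderiv ℝ (e ∘ e'.symm) z) := by
    have : X ∘ e'.symm =ᶠ[nhds z] (X ∘ e.symm) ∘ (e ∘ e'.symm) := by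
      refine Filter.eventuallyEq_of_mem ((e'.symm.trans e).open_source.mem_nhds hz) fun w hw => ?_
      have hw' : w ∈ e'.target ∧ e'.symm w ∈ e.source := by simpa using hw
      simp [e.left_inv hw'.2]
    rw [this.fderiv_eq]
    exact fderiv_comp z ((contDiffAt_comp_symm hX he (e.map_source hzt.2)).differentiableAt
      (by simp)) ((contDiffAt_transition he he' hz).differentiableAt (by simp))
  set b := (EuclideanSpace.basisFun (Fin n) ℝ).toBasis
  set J := LinearMap.toMatrix b b (fderiv ℝ (e ∘ e'.symm) z).toLinearMap with hJ
  have hdet : (fderiv ℝ (e ∘ e'.symm) z).det = J.det := (LinearMap.det_toMatrix b _).symm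
  have hJa : ∀ k i, fderiv ℝ (e ∘ e'.symm) z (EuclideanSpace.single i 1) k = J k i := by
    intro k i
    simp [hJ, b, LinearMap.toMatrix_apply]
  have hG : metricMatrix X e' z =
      J.transpose * metricMatrix X e ((e ∘ e'.symm) z) * J := by
    ext i j
    simp only [metricMatrix, Matrix.of_apply, Matrix.mul_apply, Matrix.transpose_apply]
    rw [hD]
    simp only [ContinuousLinearMap.comp_apply]
    rw [map_eq_sum _ (fderiv ℝ (e ∘ e'.symm) z (EuclideanSpace.single i 1)),
      map_eq_sum _ (fderiv ℝ (e ∘ e'.symm) z (EuclideanSpace.single j 1))]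
    simp only [sum_inner, inner_sum, inner_smul_left, inner_smul_right, conj_trivial, hJa,
      Finset.sum_mul, Finset.mul_sum]
    refine Finset.sum_congr rfl fun b _ => Finset.sum_congr rfl fun a _ => by ring
  rw [volumeDensity, hG, Matrix.det_mul, Matrix.det_mul, Matrix.det_transpose, hdet,
    mul_comm, ← mul_assoc, Real.sqrt_mul (mul_self_nonneg _), Real.sqrt_mul_self_eq_abs]
  rfl

variable [MeasurableSpace M] [BorelSpace M]

/-- Change of variables along the transition map. It is only an inequality because `e'` sees just
the part of `A` inside its own domain. -/
theorem chartVolume_le_of_subset_source (hX : ContMDiff (𝓡 n) (𝓡 m) ∞ X)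
    (he : e ∈ IsManifold.maximalAtlas (𝓡 n) ∞ M) (he' : e' ∈ IsManifold.maximalAtlas (𝓡 n) ∞ M)
    {A : Set M} (hA : MeasurableSet A) (hAe : A ⊆ e.source) :
    chartVolume X e' A ≤ chartVolume X e A := by
  rw [chartVolume_apply hA, chartVolume_apply hA]
  set S := e'.target ∩ e'.symm ⁻¹' A with hS
  have hsub : ∀ z ∈ S, z ∈ (e'.symm.trans e).source := fun z hz => by
    simpa using ⟨hz.1, hAe hz.2⟩
  have hSm : MeasurableSet S := measurableSet_target_inter_preimage e' hA
  have hinj : Set.InjOn (e ∘ e'.symm) S := fun a ha b hb hab =>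
    (e'.symm.trans e).injOn (hsub a ha) (hsub b hb) hab
  have hd : ∀ z ∈ S, HasFDerivWithinAt (e ∘ e'.symm) (fderiv ℝ (e ∘ e'.symm) z) S z :=
    fun z hz => ((contDiffAt_transition he he' (hsub z hz)).differentiableAt
      (by simp)).hasFDerivAt.hasFDerivWithinAt
  calc ∫⁻ y in S, ENNReal.ofReal (volumeDensity X e' y)
      = ∫⁻ y in S, ENNReal.ofReal |(fderiv ℝ (e ∘ e'.symm) y).det| *
          ENNReal.ofReal (volumeDensity X e ((e ∘ e'.symm) y)) :=
        setLIntegral_congr_fun hSm fun z hz => by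
          rw [volumeDensity_transition hX he he' (hsub z hz), ENNReal.ofReal_mul (abs_nonneg _)]
    _ = ∫⁻ y in (e ∘ e'.symm) '' S, ENNReal.ofReal (volumeDensity X e y) :=
        (lintegral_image_eq_lintegral_abs_det_fderiv_mul volume hSm hd hinj
          fun y => ENNReal.ofReal (volumeDensity X e y)).symm
    _ ≤ _ := by
        refine lintegral_mono_set ?_
        rintro _ ⟨z, hz, rfl⟩
        refine ⟨e.map_source (hAe hz.2), ?_⟩
        simp only [Set.mem_preimage, Function.comp_apply, e.left_inv (hAe hz.2)]
        exact hz.2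

/-- On the domain of a chart, the Riemannian measure is `√(det g_ij) dy`. -/
theorem riemVolume_restrict_source (hX : ContMDiff (𝓡 n) (𝓡 m) ∞ X)
    (he : e ∈ IsManifold.maximalAtlas (𝓡 n) ∞ M) :
    (riemVolume (n := n) X).restrict e.source = chartVolume X e := by
  have hs := e.open_source.measurableSet
  have hle : ∀ e' ∈ IsManifold.maximalAtlas (𝓡 n) ∞ M,
      chartVolume (n := n) X e' ≤ riemVolume (n := n) X := fun e' he' =>
    le_iSup₂_of_le e' he' le_rfl
  have hself : (chartVolume X e).restrict e.source = chartVolume X e := by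
    rw [Measure.restrict_eq_self_of_ae_mem]
    exact chartVolume_compl_source
  refine le_antisymm ?_ ?_
  -- Each chart measure in the supremum is split along `e.source`: inside it is at most `chartVolume
  -- X e`, outside at most `riemVolume X`. Restricting to `e.source` then kills the second summand.
  · have h1 : riemVolume (n := n) X ≤
        chartVolume X e + (riemVolume (n := n) X).restrict e.sourceᶜ := by
      refine iSup₂_le fun e' he' => Measure.le_iff.2 fun A hA => ?_
      rw [← measure_inter_add_sdiff A hs, Measure.add_apply, Measure.restrict_apply hA,
        ← Set.sdiff_eq]
      refine add_le_add ?_ (hle e' he' _)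
      exact (chartVolume_le_of_subset_source hX he he' (hA.inter hs)
        Set.inter_subset_right).trans (measure_mono Set.inter_subset_left)
    have h2 := Measure.restrict_mono_measure h1 e.source
    rwa [Measure.restrict_add, hself, Measure.restrict_restrict hs, Set.inter_compl_self,
      Measure.restrict_empty, add_zero] at h2
  · conv_lhs => rw [← hself]
    exact Measure.restrict_mono_measure (hle e he) _

/-- Every point has a compact neighbourhood inside a chart, on which the continuous density is
integrable; local finiteness and compactness of `M` conclude. -/
theorem isFiniteMeasure_riemVolume [T2Space M] [CompactSpace M]
    (hX : ContMDiff (𝓡 n) (𝓡 m) ∞ X) (hi : ∀ x, Function.Injective (mfderiv (𝓡 n) (𝓡 m) X x)) :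
    IsFiniteMeasure (riemVolume (n := n) X) := by
  have : LocallyCompactSpace M := ChartedSpace.locallyCompactSpace (EuclideanSpace ℝ (Fin n)) M
  have : IsLocallyFiniteMeasure (riemVolume (n := n) X) := by
    refine ⟨fun x => ?_⟩
    set e := chartAt (EuclideanSpace ℝ (Fin n)) x with hedef
    have he : e ∈ IsManifold.maximalAtlas (𝓡 n) ∞ M := IsManifold.chart_mem_maximalAtlas x
    obtain ⟨K, hK, hxK, hKe⟩ := exists_compact_subset e.open_source
      (mem_chart_source (EuclideanSpace ℝ (Fin n)) x)
    refine ⟨K, mem_interior_iff_mem_nhds.1 hxK, ?_⟩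
    rw [← Set.inter_eq_left.2 hKe, ← Measure.restrict_apply hK.measurableSet,
      riemVolume_restrict_source hX he, chartVolume_apply hK.measurableSet]
    have hK' : IsCompact (e '' K) := hK.image_of_continuousOn (e.continuousOn.mono hKe)
    have hsub : e.target ∩ e.symm ⁻¹' K ⊆ e '' K := fun y hy =>
      ⟨e.symm y, hy.2, e.right_inv hy.1⟩
    have hKt : e '' K ⊆ e.target := by
      rintro _ ⟨z, hz, rfl⟩
      exact e.map_source (hKe hz)
    have hint : IntegrableOn (volumeDensity X e) (e '' K) :=
      ((continuousOn_volumeDensity hX hi he).mono hKt).integrableOn_compact hK'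
    exact (lintegral_mono_set hsub).trans_lt hint.lintegral_lt_top
  infer_instance

/-- A single chart suffices: its density is positive on a nonempty open set, and the supremum
dominates its measure. -/
theorem riemVolume_univ_pos [Nonempty M]
    (hX : ContMDiff (𝓡 n) (𝓡 m) ∞ X) (hi : ∀ x, Function.Injective (mfderiv (𝓡 n) (𝓡 m) X x)) :
    0 < riemVolume (n := n) X Set.univ := by
  obtain ⟨x⟩ := ‹Nonempty M›
  set e := chartAt (EuclideanSpace ℝ (Fin n)) x with hedef
  have he : e ∈ IsManifold.maximalAtlas (𝓡 n) ∞ M := IsManifold.chart_mem_maximalAtlas x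
  have h1 : 0 < chartVolume (n := n) X e Set.univ := by
    rw [chartVolume_apply MeasurableSet.univ, Set.preimage_univ, Set.inter_univ]
    have hm : AEMeasurable (fun y => ENNReal.ofReal (volumeDensity X e y))
        (volume.restrict e.target) :=
      ((continuousOn_volumeDensity hX hi he).aemeasurable
        e.open_target.measurableSet).ennreal_ofReal
    rw [pos_iff_ne_zero, Ne, lintegral_eq_zero_iff' hm]
    intro h
    have h0 : ∀ᵐ _ ∂(volume.restrict e.target), False := by
      filter_upwards [h, ae_restrict_mem e.open_target.measurableSet] with y hy hyt
      exact (ENNReal.ofReal_pos.2 (volumeDensity_pos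
        (fderiv_comp_symm_injective hX hi he hyt))).ne' hy
    rw [Filter.eventually_false_iff_eq_bot, ae_eq_bot, Measure.restrict_eq_zero] at h0
    exact e.open_target.measure_ne_zero volume
      ⟨e x, e.map_source (mem_chart_source (EuclideanSpace ℝ (Fin n)) x)⟩ h0
  exact h1.trans_le (le_iSup₂_of_le (f := fun e _ => chartVolume (n := n) X e) e he le_rfl _)

theorem setIntegral_riemVolume (hX : ContMDiff (𝓡 n) (𝓡 m) ∞ X)
    (hi : ∀ x, Function.Injective (mfderiv (𝓡 n) (𝓡 m) X x))
    (he : e ∈ IsManifold.maximalAtlas (𝓡 n) ∞ M) {F : M → ℝ} (hF : Continuous F) :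
    ∫ x in e.source, F x ∂(riemVolume (n := n) X) =
      ∫ y in e.target, volumeDensity X e y * F (e.symm y) := by
  rw [riemVolume_restrict_source hX he, chartVolume,
    integral_map (aemeasurable_symm _ _) hF.aestronglyMeasurable,
    integral_withDensity_eq_integral_toReal_smul₀]
  · refine integral_congr_ae (Filter.Eventually.of_forall fun y => ?_)
    simp only [smul_eq_mul]
    rw [ENNReal.toReal_ofReal (Real.sqrt_nonneg _)]
    rfl
  · exact ((continuousOn_volumeDensity hX hi he).aemeasurable
      e.open_target.measurableSet).ennreal_ofReal
  · simp

end Submfd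

/-! ### The divergence theorem on a compact self-shrinker. -/

namespace Submfd

open MeasureTheory

/-- Since `g` is uncontrolled off `U`, it is replaced by its extension by zero, which is `C¹` with
compact support on the whole space. -/
theorem integral_fderiv_eq_zero_of_eq_zero_off_compact {E : Type*} [NormedAddCommGroup E]
    [NormedSpace ℝ E] [FiniteDimensional ℝ E] [MeasurableSpace E] [BorelSpace E]
    (μ : Measure E) [μ.IsAddHaarMeasure] {U K : Set E} (hU : IsOpen U) (hK : IsCompact K)
    (hKU : K ⊆ U) {g : E → ℝ} (hg : ∀ y ∈ U, ContDiffAt ℝ 1 g y)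
    (h0 : ∀ y ∈ U, y ∉ K → g y = 0) (v : E) :
    IntegrableOn (fun y => fderiv ℝ g y v) U μ ∧ ∫ y in U, fderiv ℝ g y v ∂μ = 0 := by
  set h := U.indicator g with hh
  have hK0 : ∀ y ∉ K, h y = 0 := fun y hy => by
    by_cases hyU : y ∈ U
    · rw [hh, Set.indicator_of_mem hyU, h0 y hyU hy]
    · exact Set.indicator_of_notMem hyU g
  have heq : ∀ y ∈ U, h =ᶠ[nhds y] g := fun y hy =>
    Filter.eventuallyEq_of_mem (hU.mem_nhds hy) fun z hz => Set.indicator_of_mem hz g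
  have heq0 : ∀ y ∉ K, h =ᶠ[nhds y] fun _ => 0 := fun y hy =>
    Filter.eventuallyEq_of_mem (hK.isClosed.isOpen_compl.mem_nhds hy) hK0
  have hc : ContDiff ℝ 1 h := contDiff_iff_contDiffAt.2 fun y => by
    by_cases hy : y ∈ U
    · exact (hg y hy).congr_of_eventuallyEq (heq y hy)
    · exact contDiffAt_const.congr_of_eventuallyEq (heq0 y fun hyK => hy (hKU hyK))
  have hsupp : HasCompactSupport h := HasCompactSupport.intro hK hK0
  have hder : (fun y => fderiv ℝ h y v) = U.indicator fun y => fderiv ℝ g y v := by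
    ext y
    by_cases hy : y ∈ U
    · rw [Set.indicator_of_mem hy, (heq y hy).fderiv_eq]
    · rw [Set.indicator_of_notMem hy, (heq0 y fun hyK => hy (hKU hyK)).fderiv_eq]
      simp
  have hint : Integrable (fun y => fderiv ℝ h y v) μ :=
    ((hc.continuous_fderiv (by simp)).clm_apply continuous_const).integrable_of_hasCompactSupport
      (hsupp.fderiv_apply ℝ v)
  -- Integration by parts against the constant function `1`.
  have hzero : ∫ y, fderiv ℝ h y v ∂μ = 0 := by
    have := integral_mul_fderiv_eq_neg_fderiv_mul_of_integrable (μ := μ) (f := fun _ => (1 : ℝ))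
      (g := h) (v := v) (by simp) (by simpa using hint)
      (by simpa using hc.continuous.integrable_of_hasCompactSupport hsupp)
      (fun _ _ => by fun_prop) (fun x _ => hc.differentiable (by simp) x)
    simpa using this
  rw [hder] at hint hzero
  exact ⟨(integrable_indicator_iff hU.measurableSet).1 hint,
    by rwa [integral_indicator hU.measurableSet] at hzero⟩

variable {n m : ℕ} {M : Type*} [TopologicalSpace M] [ChartedSpace (EuclideanSpace ℝ (Fin n)) M]

/-- The tangent vector field on `M` which `dX` maps to the tangential part of `X`. -/
noncomputable def tangentField (X : M → EuclideanSpace ℝ (Fin m)) (x : M) :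
    TangentSpace (𝓡 n) x :=
  mfderiv (𝓡 n) (𝓡 n) (chartAt (EuclideanSpace ℝ (Fin n)) x).symm
    (chartAt (EuclideanSpace ℝ (Fin n)) x x)
    (tangentCoord X (chartAt (EuclideanSpace ℝ (Fin n)) x)
      (chartAt (EuclideanSpace ℝ (Fin n)) x x))

/-- The derivative of `φ` along the tangential part of `X`. -/
noncomputable def tangentDerivative (X : M → EuclideanSpace ℝ (Fin m)) (φ : M → ℝ) (x : M) : ℝ :=
  mfderiv (𝓡 n) 𝓘(ℝ, ℝ) φ x (tangentField (n := n) X x)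

/-- For a self-shrinker, the divergence of `φ X^T`. -/
noncomputable def weightedDivergence (X : M → EuclideanSpace ℝ (Fin m)) (φ : M → ℝ) (x : M) : ℝ :=
  tangentDerivative (n := n) X φ x + φ x * (n - ‖normalPart (n := n) X x (X x)‖ ^ 2)

variable {X : M → EuclideanSpace ℝ (Fin m)}
  {e : OpenPartialHomeomorph M (EuclideanSpace ℝ (Fin n))} {x : M} {φ : M → ℝ}

/-- The right side is normal by the normal equations and differs from `X` by a tangent vector, which
characterizes the orthogonal projection. -/
theorem normalPart_eq_sub [IsManifold (𝓡 n) ∞ M] (hX : ContMDiff (𝓡 n) (𝓡 m) ∞ X)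
    (hi : ∀ x, Function.Injective (mfderiv (𝓡 n) (𝓡 m) X x))
    (he : e ∈ IsManifold.maximalAtlas (𝓡 n) ∞ M) (hx : x ∈ e.source) :
    normalPart (n := n) X x (X x) =
      (X ∘ e.symm) (e x) - fderiv ℝ (X ∘ e.symm) (e x) (tangentCoord X e (e x)) := by
  have hx0 : (X ∘ e.symm) (e x) = X x := by simp [e.left_inv hx]
  refine Submodule.eq_starProjection_of_mem_of_inner_eq_zero ?_ fun w hw => ?_
  · rw [Submodule.mem_orthogonal']
    rintro _ ⟨v, rfl⟩
    -- Every tangent vector comes from coordinates, where the normal equations are stated.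
    obtain ⟨u, rfl⟩ := (mfderiv_symm_bijective he hx).2 v
    have := inner_sub_fderiv_tangentCoord
      (fderiv_comp_symm_injective hX hi he (e.map_source hx)) u
    rw [fderiv_comp_symm hX he hx u] at this
    exact this
  · rw [hx0, sub_sub_cancel]
    exact (Submodule.mem_orthogonal _ w).1 hw _ (fderiv_mem_tangentPlane hX he hx _)

/-- Chart independence of the tangent field: in any chart `dX` sends it to `X - X^N`, and `dX` is
injective. -/
theorem mfderiv_symm_tangentCoord [IsManifold (𝓡 n) ∞ M] (hX : ContMDiff (𝓡 n) (𝓡 m) ∞ X)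
    (hi : ∀ x, Function.Injective (mfderiv (𝓡 n) (𝓡 m) X x))
    (he : e ∈ IsManifold.maximalAtlas (𝓡 n) ∞ M) (hx : x ∈ e.source) :
    mfderiv (𝓡 n) (𝓡 n) e.symm (e x) (tangentCoord X e (e x)) = tangentField (n := n) X x := by
  have h : ∀ e ∈ IsManifold.maximalAtlas (𝓡 n) ∞ M, x ∈ e.source →
      mfderiv (𝓡 n) (𝓡 m) X x (mfderiv (𝓡 n) (𝓡 n) e.symm (e x) (tangentCoord X e (e x))) =
        X x - normalPart (n := n) X x (X x) := by
    intro e he hx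
    rw [← fderiv_comp_symm hX he hx, normalPart_eq_sub hX hi he hx]
    simp only [Function.comp_apply, e.left_inv hx, sub_sub_cancel]
    rfl
  exact @hi x _ _ ((h e he hx).trans (h _ (IsManifold.chart_mem_maximalAtlas x)
    (mem_chart_source (EuclideanSpace ℝ (Fin n)) x)).symm)

theorem weightedDivergence_eq [IsManifold (𝓡 n) ∞ M] (hX : ContMDiff (𝓡 n) (𝓡 m) ∞ X)
    (hi : ∀ x, Function.Injective (mfderiv (𝓡 n) (𝓡 m) X x))
    (hφ : ContMDiff (𝓡 n) 𝓘(ℝ, ℝ) ∞ φ)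
    (he : e ∈ IsManifold.maximalAtlas (𝓡 n) ∞ M) (hx : x ∈ e.source) :
    weightedDivergence (n := n) X φ x =
      fderiv ℝ (φ ∘ e.symm) (e x) (tangentCoord X e (e x)) + φ x * (n - ‖(X ∘ e.symm) (e x) -
        fderiv ℝ (X ∘ e.symm) (e x) (tangentCoord X e (e x))‖ ^ 2) := by
  rw [weightedDivergence, normalPart_eq_sub hX hi he hx, fderiv_real_comp_symm hφ he hx,
    mfderiv_symm_tangentCoord hX hi he hx]
  rfl

theorem contDiffAt_real_comp_symm [IsManifold (𝓡 n) ∞ M] (hφ : ContMDiff (𝓡 n) 𝓘(ℝ, ℝ) ∞ φ)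
    (he : e ∈ IsManifold.maximalAtlas (𝓡 n) ∞ M) {y : EuclideanSpace ℝ (Fin n)}
    (hy : y ∈ e.target) : ContDiffAt ℝ ∞ (φ ∘ e.symm) y := by
  have h1 : ContMDiffAt (𝓡 n) (𝓡 n) ∞ e.symm y :=
    (contMDiffOn_symm_of_mem_maximalAtlas he).contMDiffAt (e.open_target.mem_nhds hy)
  exact ((hφ _).comp y h1).contDiffAt

theorem continuousAt_sub_fderiv_tangentCoord [IsManifold (𝓡 n) ∞ M]
    (hX : ContMDiff (𝓡 n) (𝓡 m) ∞ X)
    (hi : ∀ x, Function.Injective (mfderiv (𝓡 n) (𝓡 m) X x))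
    (he : e ∈ IsManifold.maximalAtlas (𝓡 n) ∞ M) {y : EuclideanSpace ℝ (Fin n)}
    (hy : y ∈ e.target) :
    ContinuousAt (fun y => (X ∘ e.symm) y - fderiv ℝ (X ∘ e.symm) y (tangentCoord X e y)) y := by
  have hf := contDiffAt_comp_symm hX he hy
  exact (hf.sub ((hf.fderiv_right (m := ∞) (by simp)).clm_apply
    (contDiffAt_tangentCoord hf (fderiv_comp_symm_injective hX hi he hy)))).continuousAt

/-- The projection is onto a subspace varying with `x`, so continuity is read off from the formula
in one fixed chart. -/
theorem continuous_normalPart [IsManifold (𝓡 n) ∞ M] (hX : ContMDiff (𝓡 n) (𝓡 m) ∞ X)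
    (hi : ∀ x, Function.Injective (mfderiv (𝓡 n) (𝓡 m) X x)) :
    Continuous fun x => normalPart (n := n) X x (X x) := by
  refine continuous_iff_continuousAt.2 fun x => ?_
  have he : chartAt (EuclideanSpace ℝ (Fin n)) x ∈ IsManifold.maximalAtlas (𝓡 n) ∞ M :=
    IsManifold.chart_mem_maximalAtlas x
  set e := chartAt (EuclideanSpace ℝ (Fin n)) x
  have hx : x ∈ e.source := mem_chart_source (EuclideanSpace ℝ (Fin n)) x
  refine ContinuousAt.congr ?_ (Filter.eventuallyEq_of_mem (e.open_source.mem_nhds hx)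
    fun z hz => (normalPart_eq_sub hX hi he hz).symm)
  exact ContinuousAt.comp (f := e) (g := fun y => (X ∘ e.symm) y -
      fderiv ℝ (X ∘ e.symm) y (tangentCoord X e y))
    (continuousAt_sub_fderiv_tangentCoord hX hi he (e.map_source hx)) (e.continuousAt hx)

theorem continuous_weightedDivergence [IsManifold (𝓡 n) ∞ M] (hX : ContMDiff (𝓡 n) (𝓡 m) ∞ X)
    (hi : ∀ x, Function.Injective (mfderiv (𝓡 n) (𝓡 m) X x))
    (hφ : ContMDiff (𝓡 n) 𝓘(ℝ, ℝ) ∞ φ) : Continuous (weightedDivergence (n := n) X φ) := by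
  have hN := continuous_normalPart hX hi
  suffices h : Continuous (tangentDerivative (n := n) X φ) from
    h.add (hφ.continuous.mul (continuous_const.sub (hN.norm.pow 2)))
  refine continuous_iff_continuousAt.2 fun x => ?_
  have he : chartAt (EuclideanSpace ℝ (Fin n)) x ∈ IsManifold.maximalAtlas (𝓡 n) ∞ M :=
    IsManifold.chart_mem_maximalAtlas x
  set e := chartAt (EuclideanSpace ℝ (Fin n)) x
  have hx : x ∈ e.source := mem_chart_source (EuclideanSpace ℝ (Fin n)) x
  have hy := e.map_source hx
  have h : ContinuousAt (fun y => fderiv ℝ (φ ∘ e.symm) y (tangentCoord X e y)) (e x) :=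
    (((contDiffAt_real_comp_symm hφ he hy).fderiv_right (m := ∞) (by simp)).clm_apply
      (contDiffAt_tangentCoord (contDiffAt_comp_symm hX he hy)
        (fderiv_comp_symm_injective hX hi he hy))).continuousAt
  refine ContinuousAt.congr (ContinuousAt.comp h (e.continuousAt hx))
    (Filter.eventuallyEq_of_mem (e.open_source.mem_nhds hx) fun z hz => ?_)
  -- `tangentField` at `z` uses the preferred chart of `z`; chart independence lets the fixed chart
  -- `e` serve for all nearby `z`.
  rw [tangentDerivative, ← mfderiv_symm_tangentCoord hX hi he hz, ← fderiv_real_comp_symm hφ he hz]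
  rfl

/-- This is where `H = -X^N` is used. The projection fixes `X^N` and is self-adjoint, so it can be
moved onto `g^{ki} ∂_k ∂_i X`, whose normal part is `H` in any chart. -/
theorem inner_normalPart_eq_neg [IsManifold (𝓡 n) ∞ M] (hX : IsSelfShrinker (n := n) X)
    (he : e ∈ IsManifold.maximalAtlas (𝓡 n) ∞ M) (hx : x ∈ e.source) :
    inner ℝ (normalPart (n := n) X x (X x)) (∑ k, ∑ i, (metricMatrix X e (e x))⁻¹ k i •
      fderiv ℝ (fderiv ℝ (X ∘ e.symm)) (e x) (EuclideanSpace.single k 1)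
        (EuclideanSpace.single i 1)) = -‖normalPart (n := n) X x (X x)‖ ^ 2 := by
  have hH : normalPart (n := n) X x (∑ k, ∑ i, (metricMatrix X e (e x))⁻¹ k i •
      fderiv ℝ (fderiv ℝ (X ∘ e.symm)) (e x) (EuclideanSpace.single k 1)
        (EuclideanSpace.single i 1)) = -normalPart (n := n) X x (X x) := by
    rw [← hX.shrinker x, meanCurvature, meanCurvatureInChart_eq hX.smooth
      (IsManifold.chart_mem_maximalAtlas x) he
      (mem_chart_source (EuclideanSpace ℝ (Fin n)) x) hx]
    simp only [normalPart, meanCurvatureInChart, secondFundamentalForm, map_sum, map_smul]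
  have hidem : normalPart (n := n) X x (normalPart (n := n) X x (X x)) =
      normalPart (n := n) X x (X x) :=
    Submodule.starProjection_eq_self_iff.2 (Submodule.starProjection_apply_mem _ _)
  conv_lhs => rw [← hidem]
  rw [normalPart, Submodule.inner_starProjection_left_eq_right]
  change inner ℝ (normalPart (n := n) X x (X x)) (normalPart (n := n) X x _) = _
  rw [hH, inner_neg_right, real_inner_self_eq_norm_sq]

theorem weightedDivergence_sum [IsManifold (𝓡 n) ∞ M] (hX : ContMDiff (𝓡 n) (𝓡 m) ∞ X)
    (hi : ∀ x, Function.Injective (mfderiv (𝓡 n) (𝓡 m) X x)) {ι : Type*} (s : Finset ι)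
    {φ : ι → M → ℝ} (hφ : ∀ i, ContMDiff (𝓡 n) 𝓘(ℝ, ℝ) ∞ (φ i)) (x : M) :
    weightedDivergence (n := n) X (fun x => ∑ i ∈ s, φ i x) x =
      ∑ i ∈ s, weightedDivergence (n := n) X (φ i) x := by
  have he : chartAt (EuclideanSpace ℝ (Fin n)) x ∈ IsManifold.maximalAtlas (𝓡 n) ∞ M :=
    IsManifold.chart_mem_maximalAtlas x
  set e := chartAt (EuclideanSpace ℝ (Fin n)) x
  have hx : x ∈ e.source := mem_chart_source (EuclideanSpace ℝ (Fin n)) x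
  have hsum : ContMDiff (𝓡 n) 𝓘(ℝ, ℝ) ∞ fun x => ∑ i ∈ s, φ i x :=
    contMDiff_finsetSum fun i _ => hφ i
  rw [weightedDivergence_eq hX hi hsum he hx]
  simp_rw [weightedDivergence_eq hX hi (hφ _) he hx]
  rw [Finset.sum_add_distrib, ← Finset.sum_mul]
  congr 1
  rw [show (fun x => ∑ i ∈ s, φ i x) ∘ e.symm = fun y => ∑ i ∈ s, (φ i ∘ e.symm) y from rfl,
    fderiv_fun_sum fun i _ => (contDiffAt_real_comp_symm (hφ i) he
      (e.map_source hx)).differentiableAt (by simp), sum_apply]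

variable [IsManifold (𝓡 n) ∞ M] [MeasurableSpace M] [BorelSpace M] [CompactSpace M]

/-- In the chart, density times integrand is a sum of partial derivatives of functions vanishing off
the compact set `e '' tsupport φ`; each integrates to zero. -/
theorem integral_weightedDivergence_of_tsupport_subset (hX : IsSelfShrinker (n := n) X)
    (hφ : ContMDiff (𝓡 n) 𝓘(ℝ, ℝ) ∞ φ) (he : e ∈ IsManifold.maximalAtlas (𝓡 n) ∞ M)
    (hs : tsupport φ ⊆ e.source) :
    ∫ x, weightedDivergence (n := n) X φ x ∂(riemVolume (n := n) X) = 0 := by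
  have hi := hX.immersion
  have h0 : ∀ x ∉ e.source, weightedDivergence (n := n) X φ x = 0 := by
    intro x hx
    have hφ0 : φ =ᶠ[nhds x] fun _ => 0 :=
      notMem_tsupport_iff_eventuallyEq.1 fun h => hx (hs h)
    have hd : tangentDerivative (n := n) X φ x = 0 := by
      rw [tangentDerivative, hφ0.mfderiv_eq, mfderiv_const]
      rfl
    rw [weightedDivergence, hd, hφ0.self_of_nhds, zero_mul, add_zero]
  rw [← setIntegral_eq_integral_of_forall_compl_eq_zero h0,
    setIntegral_riemVolume hX.smooth hi he (continuous_weightedDivergence hX.smooth hi hφ)]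
  have hK : IsCompact (e '' tsupport φ) :=
    (isClosed_tsupport φ).isCompact.image_of_continuousOn (e.continuousOn.mono hs)
  have hKt : e '' tsupport φ ⊆ e.target := by
    rintro _ ⟨z, hz, rfl⟩
    exact e.map_source (hs hz)
  have hdiv := fun k : Fin n => integral_fderiv_eq_zero_of_eq_zero_off_compact volume
    e.open_target hK hKt
    (g := fun z => (φ ∘ e.symm) z * (volumeDensity X e z * tangentCoord X e z k))
    (fun y hy => by
      have hf := contDiffAt_comp_symm hX.smooth he hy
      have hinj := fderiv_comp_symm_injective hX.smooth hi he hy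
      exact ((contDiffAt_real_comp_symm hφ he hy).mul ((contDiffAt_volumeDensity hf hinj).mul
        (contDiffAt_euclidean.1 (contDiffAt_tangentCoord hf hinj) k))).of_le (by norm_cast))
    (fun y hy hyK => by
      have : (φ ∘ e.symm) y = 0 := image_eq_zero_of_notMem_tsupport (f := φ) fun h =>
        hyK ⟨e.symm y, h, e.right_inv hy⟩
      rw [this, zero_mul]) (EuclideanSpace.single k 1)
  rw [setIntegral_congr_fun (g := fun y => ∑ k, fderiv ℝ
    (fun z => (φ ∘ e.symm) z * (volumeDensity X e z * tangentCoord X e z k)) y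
      (EuclideanSpace.single k 1)) e.open_target.measurableSet,
    integral_finsetSum _ fun k _ => (hdiv k).1, Finset.sum_eq_zero fun k _ => (hdiv k).2]
  intro y hy
  obtain ⟨x, hx, rfl⟩ : ∃ x ∈ e.source, e x = y := ⟨e.symm y, e.map_target hy, e.right_inv hy⟩
  beta_reduce
  rw [sum_fderiv_mul_volumeDensity_mul_tangentCoord (contDiffAt_comp_symm hX.smooth he hy)
    (eventually_fderiv_comp_symm_injective hX.smooth hi he hy)
    ((contDiffAt_real_comp_symm hφ he hy).differentiableAt (by simp)), e.left_inv hx,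
    ← normalPart_eq_sub hX.smooth hi he hx, inner_normalPart_eq_neg hX he hx,
    weightedDivergence_eq hX.smooth hi hφ he hx, ← normalPart_eq_sub hX.smooth hi he hx]
  simp [e.left_inv hx, sub_eq_add_neg]

/-- The divergence theorem for the vector field `φ X^T` on a compact self-shrinker. -/
theorem integral_weightedDivergence [T2Space M] (hX : IsSelfShrinker (n := n) X)
    (hφ : ContMDiff (𝓡 n) 𝓘(ℝ, ℝ) ∞ φ) :
    ∫ x, weightedDivergence (n := n) X φ x ∂(riemVolume (n := n) X) = 0 := by
  have := isFiniteMeasure_riemVolume hX.smooth hX.immersion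
  obtain ⟨ρ, hρ⟩ := SmoothPartitionOfUnity.exists_isSubordinate (𝓡 n) (s := (Set.univ : Set M))
    isClosed_univ (fun x : M => (chartAt (EuclideanSpace ℝ (Fin n)) x).source)
    (fun x => (chartAt _ x).open_source)
    (fun x _ => Set.mem_iUnion.2 ⟨x, mem_chart_source _ x⟩)
  -- Compactness leaves finitely many nonzero bump functions, so the decomposition of `φ` is a
  -- finite sum.
  have hfin : {i | (Function.support (ρ i)).Nonempty}.Finite :=
    ρ.locallyFinite.finite_nonempty_of_compact
  have hsum : ∀ x, φ x = ∑ i ∈ hfin.toFinset, ρ i x * φ x := by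
    intro x
    have h1 := ρ.sum_eq_one (Set.mem_univ x)
    rw [finsum_eq_sum_of_support_subset (s := hfin.toFinset)] at h1
    · rw [← Finset.sum_mul, h1, one_mul]
    · intro i hi
      exact hfin.mem_toFinset.2 ⟨x, hi⟩
  have hsm : ∀ i, ContMDiff (𝓡 n) 𝓘(ℝ, ℝ) ∞ fun x => ρ i x * φ x := fun i =>
    (ρ i).contMDiff.mul hφ
  rw [show φ = fun x => ∑ i ∈ hfin.toFinset, ρ i x * φ x from funext hsum]
  simp_rw [weightedDivergence_sum hX.smooth hX.immersion hfin.toFinset hsm]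
  rw [integral_finsetSum _ fun i _ => (continuous_weightedDivergence hX.smooth hX.immersion
    (hsm i)).integrable_of_hasCompactSupport (HasCompactSupport.of_compactSpace _)]
  refine Finset.sum_eq_zero fun i _ => integral_weightedDivergence_of_tsupport_subset hX (hsm i)
    (IsManifold.chart_mem_maximalAtlas i) ?_
  exact (closure_mono (Function.support_mul_subset_left _ _)).trans (hρ i)

end Submfd

/-! ### The test functions `1` and `exp(-|X|²/2)`. -/

namespace Submfd

open MeasureTheory

variable {n m : ℕ} {M : Type*} [TopologicalSpace M] [ChartedSpace (EuclideanSpace ℝ (Fin n)) M]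
  {X : M → EuclideanSpace ℝ (Fin m)}

theorem contMDiff_exp_neg_norm_sq (hX : ContMDiff (𝓡 n) (𝓡 m) ∞ X) :
    ContMDiff (𝓡 n) 𝓘(ℝ, ℝ) ∞ fun x => Real.exp (-‖X x‖ ^ 2 / 2) :=
  ContDiff.comp_contMDiff (g := fun v : EuclideanSpace ℝ (Fin m) => Real.exp (-‖v‖ ^ 2 / 2))
    (((contDiff_norm_sq ℝ).neg.div_const 2).exp) hX

variable [IsManifold (𝓡 n) ∞ M]

theorem weightedDivergence_one (hX : ContMDiff (𝓡 n) (𝓡 m) ∞ X)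
    (hi : ∀ x, Function.Injective (mfderiv (𝓡 n) (𝓡 m) X x)) (x : M) :
    weightedDivergence (n := n) X (fun _ => 1) x = n - ‖normalPart (n := n) X x (X x)‖ ^ 2 := by
  have he : chartAt (EuclideanSpace ℝ (Fin n)) x ∈ IsManifold.maximalAtlas (𝓡 n) ∞ M :=
    IsManifold.chart_mem_maximalAtlas x
  have hx := mem_chart_source (EuclideanSpace ℝ (Fin n)) x
  rw [weightedDivergence_eq hX hi contMDiff_const he hx, ← normalPart_eq_sub hX hi he hx]
  simp [show ((fun _ => 1 : M → ℝ) ∘ (chartAt (EuclideanSpace ℝ (Fin n)) x).symm) =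
    fun _ => 1 from rfl]

/-- Differentiating the Gaussian along `X^T` brings down `-⟨X, X^T⟩ = -|X^T|²`, which completes
`-|X^N|²` to `-|X|²`. -/
theorem weightedDivergence_exp (hX : ContMDiff (𝓡 n) (𝓡 m) ∞ X)
    (hi : ∀ x, Function.Injective (mfderiv (𝓡 n) (𝓡 m) X x)) (x : M) :
    weightedDivergence (n := n) X (fun x => Real.exp (-‖X x‖ ^ 2 / 2)) x =
      Real.exp (-‖X x‖ ^ 2 / 2) * (n - ‖X x‖ ^ 2) := by
  have he : chartAt (EuclideanSpace ℝ (Fin n)) x ∈ IsManifold.maximalAtlas (𝓡 n) ∞ M :=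
    IsManifold.chart_mem_maximalAtlas x
  have hx := mem_chart_source (EuclideanSpace ℝ (Fin n)) x
  rw [weightedDivergence_eq hX hi (contMDiff_exp_neg_norm_sq hX) he hx]
  set e := chartAt (EuclideanSpace ℝ (Fin n)) x
  have hf := contDiffAt_comp_symm hX he (e.map_source hx)
  have horth := inner_sub_fderiv_tangentCoord
    (fderiv_comp_symm_injective hX hi he (e.map_source hx)) (tangentCoord X e (e x))
  have hd : fderiv ℝ ((fun x => Real.exp (-‖X x‖ ^ 2 / 2)) ∘ e.symm) (e x)
      (tangentCoord X e (e x)) = -(Real.exp (-‖X x‖ ^ 2 / 2) * inner ℝ ((X ∘ e.symm) (e x))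
        (fderiv ℝ (X ∘ e.symm) (e x) (tangentCoord X e (e x)))) := by
    have h := (((hf.differentiableAt (by simp)).hasFDerivAt.norm_sq.neg).mul_const
      (2⁻¹ : ℝ)).exp
    rw [show ((fun x => Real.exp (-‖X x‖ ^ 2 / 2)) ∘ e.symm) = fun y =>
      Real.exp ((-fun y => ‖(X ∘ e.symm) y‖ ^ 2) y * 2⁻¹) from rfl, h.fderiv]
    simp [e.left_inv hx, div_eq_mul_inv]
  rw [hd]
  have hx0 : (X ∘ e.symm) (e x) = X x := by simp [e.left_inv hx]
  rw [hx0] at horth ⊢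
  set T := fderiv ℝ (X ∘ e.symm) (e x) (tangentCoord X e (e x))
  rw [inner_sub_left, real_inner_self_eq_norm_sq] at horth
  rw [norm_sub_sq_real]
  -- The first multiple comes from the derivative of the Gaussian, the second from the cross term of
  -- `|X - T|²`.
  linear_combination (-Real.exp (-‖X x‖ ^ 2 / 2)) * horth + 2 * Real.exp (-‖X x‖ ^ 2 / 2) * horth

end Submfd

/-! ### Extreme values against the two integral identities. -/

theorem proposition2p1 {n p : ℕ} {M : Type*} [TopologicalSpace M] [T2Space M] [CompactSpace M]
    [Nonempty M] [ChartedSpace (EuclideanSpace ℝ (Fin n)) M] [IsManifold (𝓡 n) ∞ M]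
    [MeasurableSpace M] [BorelSpace M]
    (X : M → EuclideanSpace ℝ (Fin (n + p)))
    (hX : Submfd.IsSelfShrinker (n := n) X) :
    (∃ a : ℝ, IsLeast (Set.range fun x => ‖X x‖ ^ 2) a ∧ a ≤ n) ∧
    (MeasureTheory.Integrable (fun x => Real.exp (-‖X x‖ ^ 2 / 2))
        (Submfd.riemVolume (n := n) X) ∧
      MeasureTheory.Integrable (fun x => ‖X x‖ ^ 2 * Real.exp (-‖X x‖ ^ 2 / 2))
        (Submfd.riemVolume (n := n) X) ∧
      0 < ∫ x, Real.exp (-‖X x‖ ^ 2 / 2) ∂(Submfd.riemVolume (n := n) X) ∧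
      (n : ℝ) =
        (∫ x, ‖X x‖ ^ 2 * Real.exp (-‖X x‖ ^ 2 / 2) ∂(Submfd.riemVolume (n := n) X)) /
          ∫ x, Real.exp (-‖X x‖ ^ 2 / 2) ∂(Submfd.riemVolume (n := n) X)) ∧
    (∃ b : ℝ, IsGreatest (Set.range fun x => ‖Submfd.normalPart (n := n) X x (X x)‖ ^ 2) b ∧
      (n : ℝ) ≤ b) := by
  have hfin := Submfd.isFiniteMeasure_riemVolume hX.smooth hX.immersion
  have huniv := Submfd.riemVolume_univ_pos hX.smooth hX.immersion
  have hXc : Continuous X := hX.smooth.continuous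
  have hNc := Submfd.continuous_normalPart hX.smooth hX.immersion
  set μ := Submfd.riemVolume (n := n) X
  have hint : ∀ F : M → ℝ, Continuous F → MeasureTheory.Integrable F μ := fun F hF =>
    hF.integrable_of_hasCompactSupport (HasCompactSupport.of_compactSpace _)
  have hpos : ∀ F : M → ℝ, Continuous F → (∀ x, 0 < F x) → 0 < ∫ x, F x ∂μ := by
    intro F hF h
    rw [MeasureTheory.integral_pos_iff_support_of_nonneg (fun x => (h x).le) (hint F hF),
      Function.support_eq_univ fun x => (h x).ne']
    exact huniv
  have hexp : Continuous fun x => Real.exp (-‖X x‖ ^ 2 / 2) := by fun_prop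
  have hexp2 : Continuous fun x => ‖X x‖ ^ 2 * Real.exp (-‖X x‖ ^ 2 / 2) := by fun_prop
  have hI := hpos _ hexp fun x => Real.exp_pos _
  have hgauss : (n : ℝ) * ∫ x, Real.exp (-‖X x‖ ^ 2 / 2) ∂μ =
      ∫ x, ‖X x‖ ^ 2 * Real.exp (-‖X x‖ ^ 2 / 2) ∂μ := by
    have h := Submfd.integral_weightedDivergence hX
      (Submfd.contMDiff_exp_neg_norm_sq hX.smooth)
    simp_rw [Submfd.weightedDivergence_exp hX.smooth hX.immersion] at h
    rw [← MeasureTheory.integral_const_mul, ← sub_eq_zero,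
      ← MeasureTheory.integral_sub ((hint _ hexp).const_mul _) (hint _ hexp2), ← h]
    congr 1
    ext x
    ring
  refine ⟨?_, ⟨hint _ hexp, hint _ hexp2, hI, ?_⟩, ?_⟩
  · obtain ⟨x, hx⟩ := (hXc.norm.pow 2).exists_forall_le (by
      rw [Filter.cocompact_eq_bot]; exact Filter.tendsto_bot)
    refine ⟨_, ⟨⟨x, rfl⟩, by rintro _ ⟨z, rfl⟩; exact hx z⟩, ?_⟩
    -- If the minimum exceeded `n`, then `(|X|² - n) exp(-|X|²/2)` would be positive everywhere,
    -- while its integral is zero by `hgauss`.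
    by_contra! hlt
    have h := hpos (fun z => (‖X z‖ ^ 2 - n) * Real.exp (-‖X z‖ ^ 2 / 2)) (by fun_prop)
      fun z => mul_pos (sub_pos.2 (hlt.trans_le (hx z))) (Real.exp_pos _)
    simp_rw [sub_mul] at h
    rw [MeasureTheory.integral_sub (hint _ hexp2) ((hint _ hexp).const_mul _),
      MeasureTheory.integral_const_mul, hgauss, sub_self] at h
    exact h.false
  · rw [eq_div_iff hI.ne', hgauss]
  · obtain ⟨x, hx⟩ := (hNc.norm.pow 2).exists_forall_ge (by
      rw [Filter.cocompact_eq_bot]; exact Filter.tendsto_bot)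
    refine ⟨_, ⟨⟨x, rfl⟩, by rintro _ ⟨z, rfl⟩; exact hx z⟩, ?_⟩
    -- If the maximum were below `n`, then `n - |X^N|²`, the divergence for `φ = 1`, would have a
    -- positive integral.
    by_contra! hlt
    have h := hpos (fun z => n - ‖Submfd.normalPart (n := n) X z (X z)‖ ^ 2)
      (continuous_const.sub (hNc.norm.pow 2)) fun z => sub_pos.2 ((hx z).trans_lt hlt)
    have h0 := Submfd.integral_weightedDivergence hX (φ := fun _ => 1) contMDiff_const
    simp_rw [Submfd.weightedDivergence_one hX.smooth hX.immersion] at h0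
    exact h.ne' h0
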